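/- Consider $u_t+\beta u_x=g$ with constant $\beta>0$ on $\Omega=[a,b]$, with periodic boundary conditions. Let $a=x_{1/2}<\dots<x_{N+1/2}=b$ be a mesh with cells $I_i=[x_{i-1/2},x_{i+1/2}]$, $h_i=x_{i+1/2}-x_{i-1/2}$, $h=\max_i h_i$ (cell indices are cyclic), quasi-uniform in the sense that $h\le K h_i$ for all $i$. Let $\mathbb V^k$ ($k\ge 0$) be the space of functions that are polynomials of degree at most $k$ on every cell. Every cell has subdivision points $x_{i-1/2}=x_{i,0}<x_{i,1}<\dots<x_{i,k+1}=x_{i+1/2}$ and a quadrature rule $Q_i(v)=\sum_{j=0}^{k+1}A_{i,j}v(x_{i,j})$ such that (1) $Q_i(v)=\int_{I_i}v\,dx$ for all polynomials $v$ of degree at most $2k-1$; (2) if $k\ge 1$, $\frac{h_i}{2k-1}-Q_i(L_{i,k+1}L_{i,k-1})>0$, where $L_{i,\ell}$ is the Legendre polynomial of degree $\ell$ on $I_i$ with $\int_{I_i}L_{i,\ell}^2\,dx=\frac{h_i}{2\ell+1}$ and $L_{i,\ell}(x_{i+1/2})=1$; (3) (upwind condition) $A_{i,0}=0$ for all $i$.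 For $\omega\in\mathbb V^k$ let $M^*\omega$ be the piecewise constant function whose value on $[x_{i,j},x_{i,j+1}]$, $0\le j\le k$, is $\omega(x_{i-1/2}^+)+\sum_{m=0}^{j}A_{i,m}\,\omega_x|_{I_i}(x_{i,m})$, and put $\langle v,\omega\rangle_*=\int_\Omega v\,M^*\omega\,dx$ and $\|v\|_*=\sqrt{\langle v,v\rangle_*}$ on $\mathbb V^k$. With $[v]=v^+-v^-$ denoting jumps, let $$\mathcal H(v,\omega)=\beta\Big(\sum_i Q_i(v\omega_x)+\sum_i v^-_{i+1/2}[\omega]_{i+1/2}-\sum_i A_{i+1,0}(\omega_x)^+_{i+1/2}[v]_{i+1/2}\Big).$$ An explicit $s$-stage Runge--Kutta method is given by constants $c_{\ell\kappa},d_{\ell\kappa}$ ($0\le\kappa\le\ell<s$) with $\sum_{\kappa\le\ell}c_{\ell\kappa}=1$. It has order $r$ if, for the test equation $y'=\lambda y$, its error after one step of size $\tau$ is $O((\lambda\tau)^{r+1})$ as $\lambda\tau\to0$. The RKSV scheme with time step $\tau>0$ computes $u_h^{n+1}=u_h^{n,s}$ from $u_h^{n,0}=u_h^n$ through $u_h^{n,\ell}\in\mathbb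 V^k$ with, for $0\le \ell<s$ and all $\omega\in\mathbb V^k$, $$\langle u_h^{n,\ell+1},\omega\rangle_*=\sum_{0\le\kappa\le\ell}\Big(c_{\ell\kappa}\langle u_h^{n,\kappa},\omega\rangle_*+\tau d_{\ell\kappa}\big(\mathcal H(u_h^{n,\kappa},\omega)+\langle g^{n,\kappa},M^*\omega\rangle\big)\Big).$$ **Theorem (monotonicity stability of the RKSV scheme).** Let $r\equiv 3\pmod 4$ and let an $r$-stage Runge--Kutta method of order $r$ be given. Let $\beta,K,\rho>0$ and $k\ge0$. There is a constant $C_{\mathrm{CFL}}>0$, depending only on $k$, the Runge--Kutta method, $\beta$, $K$ and $\rho$, such that for all meshes, subdivisions and quadrature rules as above with quasi-uniformity constant $K$ and (if $k\ge1$) with $\frac{h_i}{2k-1}-Q_i(L_{i,k+1}L_{i,k-1})\ge\rho h_i$ for all $i$, and for all $\tau>0$ with $\tau/h\le C_{\mathrm{CFL}}$, every solution of the RKSV scheme with $g\equiv0$ satisfies $$\|u_h^{n+1}\|_*^2\le\|u_h^n\|_*^2\qquad\text{for all } n\ge 0.$$ (For a fixed mesh, or for meshes whose cells carry an affinely scaled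 copy of one fixed subdivision and quadrature rule, a suitable $\rho$ always exists by (2); $\rho$ only records what the constant depends on.) -/

import Mathlib

open scoped Topology

noncomputable section

namespace RKSV

/-- A one-dimensional mesh with `N` cells (cell indices are cyclic, `Fin N`), each cell being
subdivided into `k + 1` control volumes, together with a quadrature rule on the subdivision points
of every cell. The domain is `[face 0, face N]`; cell `i` is `[face i, face (i + 1)]`. -/
structure Mesh (N k : ℕ) where
  /-- the cell interfaces, in increasing order -/
  face : Fin (N + 1) → ℝ
  face_strictMono : StrictMono face
  /-- the subdivision points `x_{i,0} < x_{i,1} < ⋯ < x_{i,k+1}` of cell `i` -/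
  node : Fin N → Fin (k + 2) → ℝ
  node_strictMono : ∀ i, StrictMono (node i)
  node_zero : ∀ i, node i 0 = face i.castSucc
  node_last : ∀ i, node i (Fin.last (k + 1)) = face i.succ
  /-- the quadrature weights `A_{i,j}` -/
  weight : Fin N → Fin (k + 2) → ℝ

/-- The discontinuous finite element space: a function that is a polynomial of degree at most `k`
on every cell is given by the family of its restrictions to the cells. -/
def space (N k : ℕ) : Submodule ℝ (Fin N → Polynomial ℝ) :=
  Submodule.pi Set.univ (fun _ => Polynomial.degreeLE ℝ (k : WithBot ℕ))

namespace Mesh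

variable {N k : ℕ} (M : Mesh N k)

/-- Length `h_i` of cell `i`. -/
def cellSize (i : Fin N) : ℝ := M.face i.succ - M.face i.castSucc

/-- Mesh size `h = max_i h_i`. -/
def meshSize : ℝ := ⨆ i, M.cellSize i

/-- The quadrature `Q_i(f) = ∑_j A_{i,j} f(x_{i,j})` on cell `i`. -/
def quad (i : Fin N) (f : ℝ → ℝ) : ℝ := ∑ j, M.weight i j * f (M.node i j)

/-- The Legendre polynomial of degree `l` transplanted to cell `i`, normalised to be `1` at the
right endpoint. (Mathlib's `shiftedLegendre` on `[0,1]` is normalised to be `1` at `0`.) -/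
def legendre (i : Fin N) (l : ℕ) (x : ℝ) : ℝ :=
  (-1) ^ l * Polynomial.aeval ((x - M.face i.castSucc) / M.cellSize i)
    (Polynomial.shiftedLegendre l)

/-- The quantity `h_i / (2k - 1) - Q_i(L_{i,k+1} L_{i,k-1})` (used for `k ≥ 1`). -/
def margin (i : Fin N) : ℝ :=
  M.cellSize i / (2 * (k : ℝ) - 1) -
    M.quad i (fun x => M.legendre i (k + 1) x * M.legendre i (k - 1) x)

/-- The assumption on the subdivision points and the quadrature: every `Q_i` is exact for
polynomials of degree at most `2k - 1`, and `h_i / (2k - 1) - Q_i(L_{i,k+1} L_{i,k-1}) > 0`.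
For `k = 0` both conditions are void. -/
def Admissible : Prop :=
  (∀ i, ∀ p : Polynomial ℝ, p.degree < ((2 * k : ℕ) : WithBot ℕ) →
    ∫ x in (M.face i.castSucc)..(M.face i.succ), p.eval x = M.quad i (fun x => p.eval x)) ∧
  (1 ≤ k → ∀ i, 0 < M.margin i)

/-- The upwind condition: the weight at the left endpoint of every cell vanishes. -/
def Upwind : Prop := ∀ i, M.weight i 0 = 0

/-- The constant value of `M^* w` on the control volume `[x_{i,j}, x_{i,j+1}]`:
`w(x_{i,0}^+) + ∑_{m ≤ j} A_{i,m} w_x(x_{i,m})`. -/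
def mstar (w : Fin N → Polynomial ℝ) (i : Fin N) (j : Fin (k + 1)) : ℝ :=
  (w i).eval (M.node i 0) +
    ∑ m ∈ Finset.Iic j.castSucc, M.weight i m * (w i).derivative.eval (M.node i m)

/-- The `L²` product `⟨f, M^* w⟩` over the domain, for `f` given cell by cell. -/
def pairing (f : Fin N → ℝ → ℝ) (w : Fin N → Polynomial ℝ) : ℝ :=
  ∑ i, ∑ j : Fin (k + 1),
    (∫ x in (M.node i j.castSucc)..(M.node i j.succ), f i x) * M.mstar w i j

/-- The form `⟨v, w⟩_* = ⟨v, M^* w⟩`. -/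
def starInner (v w : Fin N → Polynomial ℝ) : ℝ :=
  M.pairing (fun i x => (v i).eval x) w

/-- The energy norm `‖v‖_*`. -/
def energyNorm (v : Fin N → Polynomial ℝ) : ℝ := Real.sqrt (M.starInner v v)

/-- The trace `v^-` from the left at the right interface of cell `i`. -/
def traceLeft (v : Fin N → Polynomial ℝ) (i : Fin N) : ℝ := (v i).eval (M.face i.succ)

/-- The trace `v^+` from the right at the right interface of cell `i`, taken in the cyclically next
cell (periodic boundary conditions). -/
def traceRight [NeZero N] (v : Fin N → Polynomial ℝ) (i : Fin N) : ℝ :=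
  (v (i + 1)).eval (M.face (i + 1).castSucc)

/-- The jump `v^+ - v^-` at the right interface of cell `i`. -/
def jump [NeZero N] (v : Fin N → Polynomial ℝ) (i : Fin N) : ℝ :=
  M.traceRight v i - M.traceLeft v i

/-- The spectral volume form with upwind flux for `u_t + β u_x = g`, periodic in space:
`β (∑_i Q_i(v w_x) + ∑_i v^-_{i+1/2} [w]_{i+1/2} - ∑_i A_{i+1,0} (w_x)^+_{i+1/2} [v]_{i+1/2})`. -/
def svForm [NeZero N] (β : ℝ) (v w : Fin N → Polynomial ℝ) : ℝ :=
  β * (∑ i, M.quad i (fun x => (v i).eval x * (w i).derivative.eval x)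
    + ∑ i, M.traceLeft v i * M.jump w i
    - ∑ i, M.weight (i + 1) 0 * M.traceRight (fun l => (w l).derivative) i * M.jump v i)

end Mesh

/-- An explicit `s`-stage Runge--Kutta method in Shu--Osher form. Only the coefficients with
`κ ≤ ℓ < s` are used. -/
structure RKMethod (s : ℕ) where
  c : ℕ → ℕ → ℝ
  d : ℕ → ℕ → ℝ
  sum_c : ∀ ℓ < s, ∑ κ ∈ Finset.range (ℓ + 1), c ℓ κ = 1

/-- The stages of the method for the linear test equation `y' = λ y`, `y(0) = 1`, with `z = λ τ`. -/
def RKMethod.testStage {s : ℕ} (rk : RKMethod s) (z : ℝ) : ℕ → ℝ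
  | 0 => 1
  | ℓ + 1 => ∑ κ : Fin (ℓ + 1),
      (rk.c ℓ κ * rk.testStage z κ + z * rk.d ℓ κ * rk.testStage z κ)
decreasing_by all_goals exact κ.isLt

/-- The method is of order `r` (for linear autonomous equations): after one step, the error for
the test equation `y' = λ y` is `O((λ τ)^(r+1))`. -/
def RKMethod.HasOrder {s : ℕ} (rk : RKMethod s) (r : ℕ) : Prop :=
  (fun z : ℝ => rk.testStage z s - Real.exp z) =O[𝓝 0] (fun z : ℝ => z ^ (r + 1))

/-- `u` is a numerical solution of the fully discrete RKSV scheme with time step `τ` for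
`u_t + β u_x = g`, with periodic boundary conditions; `g n κ` is the source at stage `κ` of step
`n` and `U n ℓ` are the stages of step `n`. -/
def IsSolution {N k s : ℕ} [NeZero N] (M : Mesh N k) (rk : RKMethod s) (β τ : ℝ)
    (g : ℕ → ℕ → ℝ → ℝ) (u : ℕ → Fin N → Polynomial ℝ) : Prop :=
  ∃ U : ℕ → ℕ → Fin N → Polynomial ℝ,
    (∀ n, ∀ ℓ ≤ s, U n ℓ ∈ space N k) ∧
    (∀ n, U n 0 = u n) ∧
    (∀ n, ∀ ℓ < s, ∀ w ∈ space N k,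
      M.starInner (U n (ℓ + 1)) w =
        ∑ κ ∈ Finset.range (ℓ + 1),
          (rk.c ℓ κ * M.starInner (U n κ) w +
            τ * rk.d ℓ κ * (M.svForm β (U n κ) w + M.pairing (fun _ => g n κ) w))) ∧
    (∀ n, u (n + 1) = U n s)

end RKSV

end

namespace RKSV

open Polynomial

/-! Two facts combine. In space, `⟨·,·⟩_*` is an inner product on the discrete space, and for it the
spectral volume form is dissipative and bounded by a multiple of `1/h`. In time, the truncated
exponential of degree `r ≡ 3 (mod 4)` of a small dissipative operator is a contraction.

Space. On each cell, Abel summation against an antiderivative `V` of `v` shows that `⟨v,w⟩_*` is `∫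
v w` plus the quadrature error of `V w_x`. This product has degree `2k`, so only its top coefficient
contributes, and the correction is symmetric of rank one (`starInner_eq`). The margin condition
measures exactly this error, through the orthogonal pair `L_{k+1}`, `L_{k-1}` (`margin_eq`). The
highest Legendre mode thus keeps a positive weight and `⟨·,·⟩_*` controls the `L²` norm
(`le_cellIntegral_add_massDefect`). Exactness and the upwind condition reduce `H` to the upwind
discontinuous Galerkin form, whose diagonal is `-β/2` times the sum of squared jumps
(`svForm_self_nonpos`). Inverse and trace inequalities bound it (`abs_svForm_le`).

Time. Let `D` be `τ` times the operator representing `H`. An `r`-stage method of order `r` can only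
have the stability polynomial `∑_{i ≤ r} z^i/i!`. Put `f i j = ⟨D^i u, D^j u⟩`, let `g i j` be the
dissipation form at the same vectors, and write `r + 1 = 2m`. The new energy is the sum of `f i j /
(i! j!)` over the square `i, j ≤ r`. Over the triangle `i + j ≤ r + 1` this sum collapses to `f 0 0`
minus a sum of `g i j / (i! j! (i+j+1))`, whose `m × m` block is positive definite because
`1/(i+j+1)` is the Hilbert matrix. The square lacks the two corners `f 0 (2m)` and `f (2m) 0` of the
triangle. Shifting powers of `D` turns each into `(-1)^m f m m` up to small terms, and `m` is even
exactly when `r ≡ 3 (mod 4)`. So both gains have the right sign, and they absorb all remaining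
terms, which are smaller by a factor `δ` (`DissipativeGram.sum_le`). -/

/-! ### Integration of polynomials on the unit interval. -/

/-- Integration of polynomials over `[0, 1]`. -/
noncomputable def unitIntegral : ℝ[X] →ₗ[ℝ] ℝ where
  toFun p := ∫ x in (0 : ℝ)..1, p.eval x
  map_add' p q := by
    simp only [eval_add]
    exact intervalIntegral.integral_add (p.continuous.intervalIntegrable _ _)
      (q.continuous.intervalIntegrable _ _)
  map_smul' c p := by simp [eval_smul, intervalIntegral.integral_const_mul]

theorem unitIntegral_apply (p : ℝ[X]) : unitIntegral p = ∫ x in (0 : ℝ)..1, p.eval x := rfl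

theorem unitIntegral_derivative (p : ℝ[X]) :
    unitIntegral (derivative p) = p.eval 1 - p.eval 0 := by
  rw [unitIntegral_apply]
  exact intervalIntegral.integral_eq_sub_of_hasDerivAt (fun x _ => p.hasDerivAt x)
    ((derivative p).continuous.intervalIntegrable _ _)

theorem unitIntegral_mul_derivative (p q : ℝ[X]) :
    unitIntegral (p * derivative q) =
      p.eval 1 * q.eval 1 - p.eval 0 * q.eval 0 - unitIntegral (derivative p * q) := by
  have h := unitIntegral_derivative (p * q)
  rw [derivative_mul, map_add, eval_mul, eval_mul] at h
  linarith

theorem unitIntegral_X_pow (n : ℕ) : unitIntegral (X ^ n) = 1 / ((n : ℝ) + 1) := by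
  simp [unitIntegral_apply, integral_pow]

theorem unitIntegral_sq_nonneg (p : ℝ[X]) : 0 ≤ unitIntegral (p ^ 2) := by
  rw [unitIntegral_apply]
  exact intervalIntegral.integral_nonneg zero_le_one (fun x _ => by rw [eval_pow]; positivity)

theorem unitIntegral_sq_pos {p : ℝ[X]} (hp : p ≠ 0) : 0 < unitIntegral (p ^ 2) := by
  refine lt_of_le_of_ne (unitIntegral_sq_nonneg p) fun h => hp ?_
  have hc : Continuous fun x => (p ^ 2).eval x := (p ^ 2).continuous
  have h0 : ∀ x ∈ Set.Ioo (0 : ℝ) 1, p.eval x = 0 := by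
    by_contra! hx
    obtain ⟨x, hx, hne⟩ := hx
    have : 0 < ∫ x in (0 : ℝ)..1, (p ^ 2).eval x :=
      intervalIntegral.integral_pos zero_lt_one hc.continuousOn
        (fun x _ => by rw [eval_pow]; positivity)
        ⟨x, Set.Ioo_subset_Icc_self hx, by rw [eval_pow]; positivity⟩
    rw [unitIntegral_apply] at h
    linarith
  exact eq_zero_of_infinite_isRoot p
    ((Set.Ioo_infinite (zero_lt_one' ℝ)).mono fun x hx => h0 x hx)

theorem unitIntegral_cauchy_schwarz (p q : ℝ[X]) :
    unitIntegral (p * q) ^ 2 ≤ unitIntegral (p ^ 2) * unitIntegral (q ^ 2) := by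
  have key : ∀ t : ℝ, 0 ≤ unitIntegral (q ^ 2) * (t * t) + (2 * unitIntegral (p * q)) * t
      + unitIntegral (p ^ 2) := by
    intro t
    have h := unitIntegral_sq_nonneg (p + t • q)
    have e : (p + t • q) ^ 2 = p ^ 2 + (2 * t) • (p * q) + (t * t) • q ^ 2 := by
      simp only [smul_eq_C_mul, C_mul, map_ofNat]
      ring
    rw [e, map_add, map_add, map_smul, map_smul, smul_eq_mul, smul_eq_mul] at h
    linarith
  have := discrim_le_zero key
  unfold discrim at this
  linarith

/-- The `L²` norm on `[0, 1]` controls the coefficients of a polynomial of bounded degree. -/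
theorem exists_coeff_sq_le_unitIntegral (n : ℕ) :
    ∃ c : ℝ, 0 < c ∧ ∀ p : ℝ[X], p.degree < n →
      c * ∑ i ∈ Finset.range n, p.coeff i ^ 2 ≤ unitIntegral (p ^ 2) := by
  rcases Nat.eq_zero_or_pos n with rfl | hn
  · exact ⟨1, one_pos, fun p _ => by simpa using unitIntegral_sq_nonneg p⟩
  have : Nonempty (Fin n) := ⟨⟨0, hn⟩⟩
  let q : EuclideanSpace ℝ (Fin n) → ℝ[X] := fun x => ∑ i, x i • X ^ (i : ℕ)
  have hq : ∀ x, unitIntegral (q x ^ 2) =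
      ∑ i, ∑ j, x i * x j * (1 / (((i + j : ℕ) : ℝ) + 1)) := by
    intro x
    simp only [q, sq, Finset.sum_mul_sum, map_sum]
    refine Finset.sum_congr rfl fun i _ => Finset.sum_congr rfl fun j _ => ?_
    rw [smul_mul_smul_comm, map_smul, ← pow_add, unitIntegral_X_pow, smul_eq_mul]
  have hcoeff : ∀ x (i : Fin n), (q x).coeff i = x i := by
    intro x i
    simp [q, finsetSum_coeff, coeff_X_pow, Fin.val_inj]
  have hcont : Continuous fun x => unitIntegral (q x ^ 2) := by
    simp only [hq]
    fun_prop
  -- The constant is the minimum of a continuous positive quadratic form on the compact unit sphere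
  -- of coefficient vectors; homogeneity extends the bound to all polynomials.
  obtain ⟨x₀, hx₀, hmin⟩ := (isCompact_sphere (0 : EuclideanSpace ℝ (Fin n)) 1).exists_isMinOn
    ((NormedSpace.sphere_nonempty).2 zero_le_one) hcont.continuousOn
  have hx₀' : x₀ ≠ 0 := by
    rintro rfl
    simp at hx₀
  refine ⟨unitIntegral (q x₀ ^ 2), unitIntegral_sq_pos fun h => hx₀' ?_, fun p hp => ?_⟩
  · ext i
    rw [← hcoeff, h]
    simp
  · let y : EuclideanSpace ℝ (Fin n) := WithLp.toLp 2 fun i => p.coeff i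
    have hy : q y = p := by
      ext m
      by_cases hm : m < n
      · exact hcoeff y ⟨m, hm⟩
      · rw [coeff_eq_zero_of_degree_lt (hp.trans_le (by exact_mod_cast not_lt.1 hm))]
        simp only [q, finsetSum_coeff, coeff_smul, coeff_X_pow]
        refine Finset.sum_eq_zero fun i _ => ?_
        rw [if_neg (by have := i.2; omega)]
        simp
    have hny : ‖y‖ ^ 2 = ∑ i ∈ Finset.range n, p.coeff i ^ 2 := by
      rw [EuclideanSpace.norm_sq_eq, Finset.sum_range]
      simp [y]
    rw [← hny]
    by_cases h0 : y = 0
    · rw [h0]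
      simpa using unitIntegral_sq_nonneg p
    have hpos : 0 < ‖y‖ := norm_pos_iff.2 h0
    have hs : (‖y‖⁻¹ • y) ∈ Metric.sphere (0 : EuclideanSpace ℝ (Fin n)) 1 := by
      simp [norm_smul, hpos.ne']
    have hm := isMinOn_iff.1 hmin _ hs
    have hqs : q (‖y‖⁻¹ • y) = ‖y‖⁻¹ • p := by
      rw [← hy]
      simp [q, Finset.smul_sum, smul_smul]
    rw [hqs, _root_.smul_pow, map_smul, smul_eq_mul, inv_pow] at hm
    calc _ ≤ ((‖y‖ ^ 2)⁻¹ * unitIntegral (p ^ 2)) * ‖y‖ ^ 2 := by gcongr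
      _ = _ := by field_simp

theorem unitIntegral_mul_iterate_derivative (p w : ℝ[X]) (n : ℕ)
    (h0 : ∀ m < n, (derivative^[m] w).eval 0 = 0) (h1 : ∀ m < n, (derivative^[m] w).eval 1 = 0) :
    unitIntegral (p * derivative^[n] w) = (-1) ^ n * unitIntegral (derivative^[n] p * w) := by
  induction n generalizing p with
  | zero => simp
  | succ n ih =>
    rw [Function.iterate_succ_apply', unitIntegral_mul_derivative, h0 n n.lt_succ_self,
      h1 n n.lt_succ_self, ih (derivative p) (fun m hm => h0 m (hm.trans n.lt_succ_self))
        (fun m hm => h1 m (hm.trans n.lt_succ_self)), Function.iterate_succ_apply, pow_succ]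
    ring

/-- Euler's beta integral, by parts in the exponent of `1 - X`. With `a = b = n` it normalises the
Legendre polynomials. -/
theorem unitIntegral_X_pow_mul_one_sub_X_pow (a b : ℕ) :
    unitIntegral (X ^ a * (1 - X) ^ b) =
      (a.factorial * b.factorial : ℝ) / ((a + b + 1).factorial : ℝ) := by
  induction b generalizing a with
  | zero =>
    rw [pow_zero, mul_one, unitIntegral_X_pow, add_zero, Nat.factorial_succ]
    have := Nat.factorial_pos a
    push_cast
    field_simp
    simp
  | succ b ih =>
    have h := unitIntegral_mul_derivative ((1 - X) ^ (b + 1)) (X ^ (a + 1))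
    have e1 : (1 - X : ℝ[X]) ^ (b + 1) * derivative (X ^ (a + 1)) =
        ((a : ℝ) + 1) • (X ^ a * (1 - X) ^ (b + 1)) := by
      rw [derivative_X_pow, smul_eq_C_mul, Nat.add_sub_cancel]
      push_cast
      simp only [map_add, map_natCast, map_one]
      ring
    have e2 : derivative ((1 - X : ℝ[X]) ^ (b + 1)) * X ^ (a + 1) =
        (-((b : ℝ) + 1)) • (X ^ (a + 1) * (1 - X) ^ b) := by
      rw [derivative_pow, smul_eq_C_mul, Nat.add_sub_cancel]
      simp only [derivative_sub, derivative_one, derivative_X]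
      push_cast
      simp only [map_add, map_natCast, map_one, map_neg]
      ring
    rw [e1, e2, map_smul, map_smul, ih] at h
    simp only [eval_pow, eval_sub, eval_one, eval_X, sub_self, smul_eq_mul] at h
    have h' : ((a : ℝ) + 1) * unitIntegral (X ^ a * (1 - X) ^ (b + 1)) =
        ((b : ℝ) + 1) * (((a + 1).factorial * b.factorial : ℝ) / ((a + 1 + b + 1).factorial : ℝ)) := by
      rw [h]
      simp only [zero_pow (Nat.succ_ne_zero _)]
      ring
    rw [show a + (b + 1) + 1 = a + 1 + b + 1 by ring]
    have ha : ((a : ℝ) + 1) ≠ 0 := by positivity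
    refine mul_left_cancel₀ ha (h'.trans ?_)
    rw [Nat.factorial_succ a, Nat.factorial_succ b]
    push_cast
    ring

/-! ### Legendre polynomials: orthogonality, norms and leading coefficients. -/

/-- The real Legendre polynomial on `[0, 1]`, with value `1` at the right endpoint. -/
noncomputable def unitLegendre (n : ℕ) : ℝ[X] :=
  C ((-1) ^ n) * (shiftedLegendre n).map (Int.castRingHom ℝ)

theorem coeff_unitLegendre_self (n : ℕ) : (unitLegendre n).coeff n = (n.centralBinom : ℝ) := by
  rw [unitLegendre, coeff_C_mul, coeff_map, coeff_shiftedLegendre, Nat.centralBinom_eq_two_mul_choose]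
  simp only [Nat.choose_self, eq_intCast]
  push_cast
  rw [mul_one, ← mul_assoc, ← pow_add, ← two_mul, pow_mul]
  simp [two_mul]

theorem degree_unitLegendre_le (n : ℕ) : (unitLegendre n).degree ≤ n := by
  rw [unitLegendre, ← smul_eq_C_mul]
  exact (degree_smul_le _ _).trans (degree_map_le.trans (degree_shiftedLegendre n).le)

theorem factorial_smul_unitLegendre (n : ℕ) :
    (n.factorial : ℝ) • unitLegendre n =
      ((-1 : ℝ) ^ n) • derivative^[n] (X ^ n * (1 - X) ^ n) := by
  have h := congrArg (Polynomial.map (Int.castRingHom ℝ)) (factorial_mul_shiftedLegendre_eq n)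
  rw [Polynomial.map_mul, ← Polynomial.iterate_derivative_map] at h
  simp only [Polynomial.map_natCast, Polynomial.map_mul, Polynomial.map_pow, Polynomial.map_sub,
    Polynomial.map_one, map_X] at h
  rw [← h, unitLegendre, smul_eq_C_mul, smul_eq_C_mul, map_natCast]
  ring

/-- Rodrigues' formula followed by `n` integrations by parts; the sign of the normalisation cancels
the sign produced by the integrations. -/
theorem unitIntegral_mul_unitLegendre (p : ℝ[X]) (n : ℕ) :
    (n.factorial : ℝ) * unitIntegral (p * unitLegendre n) =
      unitIntegral (derivative^[n] p * (X ^ n * (1 - X) ^ n)) := by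
  have hz : ∀ m < n, ∀ x : ℝ, x = 0 ∨ x = 1 →
      (derivative^[m] (X ^ n * (1 - X) ^ n : ℝ[X])).eval x = 0 := by
    intro m hm x hx
    -- Every boundary term vanishes, since fewer than `n` derivatives leave a zero at both
    -- endpoints.
    have hdvd : (X * (1 - X) : ℝ[X]) ^ (n - m) ∣ derivative^[m] (X ^ n * (1 - X) ^ n) :=
      pow_sub_dvd_iterate_derivative_of_pow_dvd m (by rw [mul_pow])
    refine eval_eq_zero_of_dvd_of_eval_eq_zero hdvd ?_
    rcases hx with rfl | rfl <;> simp [Nat.sub_ne_zero_of_lt hm]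
  have h := unitIntegral_mul_iterate_derivative p (X ^ n * (1 - X) ^ n) n
    (fun m hm => hz m hm 0 (Or.inl rfl)) (fun m hm => hz m hm 1 (Or.inr rfl))
  rw [← smul_eq_mul, ← map_smul, ← mul_smul_comm, factorial_smul_unitLegendre, mul_smul_comm,
    map_smul, h, smul_eq_mul, ← mul_assoc, ← mul_pow]
  simp

theorem unitIntegral_mul_unitLegendre_of_degree_lt {p : ℝ[X]} {n : ℕ} (hp : p.degree < n) :
    unitIntegral (p * unitLegendre n) = 0 := by
  have h := unitIntegral_mul_unitLegendre p n
  have h0 : derivative^[n] p = 0 := by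
    by_cases hp0 : p = 0
    · simp [hp0]
    · exact iterate_derivative_eq_zero ((natDegree_lt_iff_degree_lt hp0).2 hp)
  rw [h0, zero_mul, map_zero] at h
  exact (mul_eq_zero.1 h).resolve_left (by exact_mod_cast n.factorial_ne_zero)

theorem unitIntegral_X_pow_mul_unitLegendre (n : ℕ) :
    unitIntegral (X ^ n * unitLegendre n) = 1 / ((2 * (n : ℝ) + 1) * n.centralBinom) := by
  have h := unitIntegral_mul_unitLegendre (X ^ n) n
  rw [iterate_derivative_X_pow_eq_smul, Nat.sub_self, pow_zero, smul_mul_assoc, one_mul,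
    Nat.descFactorial_self, map_smul, unitIntegral_X_pow_mul_one_sub_X_pow, smul_eq_mul] at h
  have hf : (n.factorial : ℝ) ≠ 0 := by exact_mod_cast n.factorial_ne_zero
  have h2 := mul_left_cancel₀ hf h
  rw [h2, ← two_mul, Nat.factorial_succ]
  have hc : (n.centralBinom : ℝ) * n.factorial * n.factorial = (2 * n).factorial := by
    have := Nat.choose_mul_factorial_mul_factorial (show n ≤ 2 * n by omega)
    rw [show 2 * n - n = n by omega] at this
    rw [Nat.centralBinom_eq_two_mul_choose]
    exact_mod_cast this
  have hcb : (n.centralBinom : ℝ) ≠ 0 := by exact_mod_cast n.centralBinom_ne_zero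
  have hff : ((2 * n).factorial : ℝ) ≠ 0 := by exact_mod_cast (2 * n).factorial_ne_zero
  push_cast
  rw [← hc]
  field_simp

/-- By orthogonality to lower degrees only the top monomial is seen. -/
theorem unitIntegral_mul_unitLegendre_of_degree_le {p : ℝ[X]} {n : ℕ} (hp : p.degree ≤ n) :
    unitIntegral (p * unitLegendre n) =
      p.coeff n / ((2 * (n : ℝ) + 1) * n.centralBinom) := by
  have hlow : (p - p.coeff n • X ^ n).degree < (n : WithBot ℕ) := by
    refine (degree_lt_iff_coeff_zero _ _).2 fun m hm => ?_
    rw [coeff_sub, coeff_smul, coeff_X_pow, smul_eq_mul]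
    rcases hm.eq_or_lt with rfl | hm
    · simp
    · rw [if_neg hm.ne', coeff_eq_zero_of_degree_lt (hp.trans_lt (by exact_mod_cast hm))]
      simp
  have h := unitIntegral_mul_unitLegendre_of_degree_lt hlow
  rw [sub_mul, map_sub, smul_mul_assoc, map_smul, unitIntegral_X_pow_mul_unitLegendre, smul_eq_mul,
    sub_eq_zero] at h
  rw [h]
  ring

theorem unitIntegral_unitLegendre_sq (n : ℕ) :
    unitIntegral (unitLegendre n ^ 2) = 1 / (2 * (n : ℝ) + 1) := by
  have hcb : (n.centralBinom : ℝ) ≠ 0 := by exact_mod_cast n.centralBinom_ne_zero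
  rw [sq, unitIntegral_mul_unitLegendre_of_degree_le (degree_unitLegendre_le n),
    coeff_unitLegendre_self]
  field_simp

/-- The Legendre mode of highest degree is dominated by the `L²` norm. -/
theorem coeff_sq_div_le_unitIntegral {p : ℝ[X]} {n : ℕ} (hp : p.degree ≤ n) :
    p.coeff n ^ 2 / ((2 * (n : ℝ) + 1) * (n.centralBinom : ℝ) ^ 2) ≤ unitIntegral (p ^ 2) := by
  have hcb : (0 : ℝ) < n.centralBinom := by exact_mod_cast n.centralBinom_pos
  have h := unitIntegral_cauchy_schwarz p (unitLegendre n)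
  rw [unitIntegral_mul_unitLegendre_of_degree_le hp, unitIntegral_unitLegendre_sq, mul_one_div,
    le_div_iff₀ (by positivity)] at h
  refine le_trans (le_of_eq ?_) h
  field_simp

/-- The relation between consecutive leading coefficients of Legendre polynomials. -/
theorem centralBinom_mul_centralBinom {k : ℕ} (hk : 1 ≤ k) :
    (((k + 1).centralBinom : ℝ) * ((k - 1).centralBinom : ℝ)) * (((k : ℝ) + 1) * (2 * k - 1)) =
      (k.centralBinom : ℝ) ^ 2 * ((2 * k + 1) * k) := by
  obtain ⟨m, rfl⟩ : ∃ m, k = m + 1 := ⟨k - 1, by omega⟩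
  have h1 := Nat.succ_mul_centralBinom_succ (m + 1)
  have h2 := Nat.succ_mul_centralBinom_succ m
  have h1' : ((m : ℝ) + 1 + 1) * (m + 1 + 1).centralBinom =
      2 * (2 * (m + 1) + 1) * (m + 1).centralBinom := by exact_mod_cast h1
  have h2' : ((m : ℝ) + 1) * (m + 1).centralBinom = 2 * (2 * m + 1) * m.centralBinom := by
    exact_mod_cast h2
  rw [Nat.add_sub_cancel]
  push_cast
  calc _ = (((m : ℝ) + 1 + 1) * (m + 1 + 1).centralBinom) * ((2 * m + 1) * m.centralBinom) := by
        ring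
    _ = _ := by
      rw [h1']
      linear_combination (-((2 * ((m : ℝ) + 1) + 1) * (m + 1).centralBinom)) * h2'

/-! ### The energy balance of the truncated exponential. -/

theorem sum_range_sum_antidiagonal (N : ℕ) (F : ℕ → ℕ → ℝ) :
    ∑ n ∈ Finset.range N, ∑ p ∈ Finset.HasAntidiagonal.antidiagonal n, F p.1 p.2 =
      ∑ i ∈ Finset.range N, ∑ j ∈ Finset.range N, if i + j < N then F i j else 0 := by
  rw [← Finset.sum_product' (f := fun i j => if i + j < N then F i j else 0), ← Finset.sum_filter,
    ← Finset.sum_fiberwise_of_maps_to (t := Finset.range N) (g := fun p : ℕ × ℕ => p.1 + p.2)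
      (fun p hp => by simpa using (Finset.mem_filter.1 hp).2)]
  refine Finset.sum_congr rfl fun n hn => Finset.sum_congr ?_ fun _ _ => rfl
  ext p
  have := Finset.mem_range.1 hn
  simp only [Finset.HasAntidiagonal.mem_antidiagonal, Finset.mem_filter, Finset.mem_product, Finset.mem_range]
  omega

theorem abs_sum_sum_ite_le (N : ℕ) (P : ℕ → ℕ → Prop) [∀ i j, Decidable (P i j)]
    (F : ℕ → ℕ → ℝ) {B : ℝ} (hB : 0 ≤ B) (hF : ∀ i j, P i j → |F i j| ≤ B) :
    |∑ i ∈ Finset.range N, ∑ j ∈ Finset.range N, if P i j then F i j else 0| ≤ (N : ℝ) ^ 2 * B := by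
  have h1 : ∀ i j, |if P i j then F i j else 0| ≤ B := by
    intro i j
    split_ifs with h
    · exact hF i j h
    · simpa using hB
  calc _ ≤ ∑ i ∈ Finset.range N, ∑ j ∈ Finset.range N, |if P i j then F i j else 0| :=
        (Finset.abs_sum_le_sum_abs _ _).trans
          (Finset.sum_le_sum fun i _ => Finset.abs_sum_le_sum_abs _ _)
    _ ≤ ∑ i ∈ Finset.range N, ∑ j ∈ Finset.range N, B :=
        Finset.sum_le_sum fun i _ => Finset.sum_le_sum fun j _ => h1 i j
    _ = _ := by
      simp
      ring

/-- Gram data of a sequence `v, D v, D² v, …`: `f i j` stands for `⟨Dⁱ v, Dʲ v⟩` and `g i j` for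
the dissipation form `-(⟨D Dⁱ v, Dʲ v⟩ + ⟨Dⁱ v, D Dʲ v⟩)`, where `D` is small of size `δ ^ 2`. -/
structure DissipativeGram (f g : ℕ → ℕ → ℝ) (δ : ℝ) : Prop where
  f_symm : ∀ i j, f i j = f j i
  f_nonneg : ∀ i, 0 ≤ f i i
  g_nonneg : ∀ i, 0 ≤ g i i
  f_sq_le : ∀ i j, f i j ^ 2 ≤ f i i * f j j
  g_sq_le : ∀ i j, g i j ^ 2 ≤ g i i * g j j
  f_add : ∀ i j, f (i + 1) j + f i (j + 1) = -g i j
  f_succ_le : ∀ i, f (i + 1) (i + 1) ≤ δ ^ 4 * f i i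
  g_le : ∀ i, g i i ≤ δ ^ 2 * f i i
  δ_nonneg : 0 ≤ δ
  δ_le_one : δ ≤ 1

namespace DissipativeGram

variable {f g : ℕ → ℕ → ℝ} {δ : ℝ}

/-- The quantity dominating the high order terms of the energy balance. -/
def bulk (f g : ℕ → ℕ → ℝ) (m : ℕ) : ℝ := f m m + ∑ i ∈ Finset.range m, g i i

/-- Algebraic counterpart of `d/dt ‖e^{tD} u‖² = -J(e^{tD} u, e^{tD} u)`, compared at order `t^n`.
-/
theorem sum_antidiagonal_succ (h : DissipativeGram f g δ) (n : ℕ) :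
    ∑ p ∈ Finset.HasAntidiagonal.antidiagonal (n + 1), f p.1 p.2 / (p.1.factorial * p.2.factorial) =
      -∑ p ∈ Finset.HasAntidiagonal.antidiagonal n,
        g p.1 p.2 / (p.1.factorial * p.2.factorial * ((p.1 + p.2 : ℕ) + 1)) := by
  have hn : (n : ℝ) + 1 ≠ 0 := by positivity
  have hfac : ∀ m : ℕ, (m.factorial : ℝ) ≠ 0 := fun m => by exact_mod_cast m.factorial_ne_zero
  refine mul_left_cancel₀ hn ?_
  -- Writing `n + 1 = i + j` lets each half cancel one factor of a factorial; after an index shift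
  -- the halves recombine through `f_add`.
  have e1 : ((n : ℝ) + 1) * ∑ p ∈ Finset.HasAntidiagonal.antidiagonal (n + 1),
        f p.1 p.2 / (p.1.factorial * p.2.factorial) =
      ∑ p ∈ Finset.HasAntidiagonal.antidiagonal (n + 1), (p.1 : ℝ) * (f p.1 p.2 / (p.1.factorial * p.2.factorial))
      + ∑ p ∈ Finset.HasAntidiagonal.antidiagonal (n + 1),
          (p.2 : ℝ) * (f p.1 p.2 / (p.1.factorial * p.2.factorial)) := by
    rw [Finset.mul_sum, ← Finset.sum_add_distrib]
    refine Finset.sum_congr rfl fun p hp => ?_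
    have : ((n : ℝ) + 1) = p.1 + p.2 := by
      have := Finset.HasAntidiagonal.mem_antidiagonal.1 hp
      exact_mod_cast this.symm
    rw [this, add_mul]
  rw [e1, Finset.Nat.sum_antidiagonal_succ, Finset.Nat.sum_antidiagonal_succ', mul_neg,
    Finset.mul_sum, ← Finset.sum_neg_distrib]
  simp only [Nat.cast_zero, zero_mul, zero_add]
  rw [← Finset.sum_add_distrib]
  refine Finset.sum_congr rfl fun p hp => ?_
  have hp' : p.1 + p.2 = n := Finset.HasAntidiagonal.mem_antidiagonal.1 hp
  have h1 := hfac p.1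
  have h2 := hfac p.2
  have hg : g p.1 p.2 = -(f (p.1 + 1) p.2 + f p.1 (p.2 + 1)) := by rw [h.f_add, neg_neg]
  rw [hp', hg, Nat.factorial_succ, Nat.factorial_succ]
  push_cast
  have h3 : (p.1 : ℝ) + 1 ≠ 0 := by positivity
  have h4 : (p.2 : ℝ) + 1 ≠ 0 := by positivity
  field_simp

theorem f_antitone (h : DissipativeGram f g δ) : Antitone fun i => f i i :=
  antitone_nat_of_succ_le fun i => (h.f_succ_le i).trans
    (mul_le_of_le_one_left (h.f_nonneg i) (pow_le_one₀ h.δ_nonneg h.δ_le_one))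

theorem bulk_nonneg (h : DissipativeGram f g δ) (m : ℕ) : 0 ≤ bulk f g m :=
  add_nonneg (h.f_nonneg m) (Finset.sum_nonneg fun i _ => h.g_nonneg i)

theorem f_le_bulk (h : DissipativeGram f g δ) (m : ℕ) : f m m ≤ bulk f g m :=
  le_add_of_nonneg_right (Finset.sum_nonneg fun i _ => h.g_nonneg i)

/-- Below `m` the entry is a summand of the bulk; from `m` on it is dominated by `f m m`, because
`f` decreases along the diagonal. -/
theorem g_diag_le_bulk (h : DissipativeGram f g δ) (m i : ℕ) : g i i ≤ bulk f g m := by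
  by_cases hi : i < m
  · exact (Finset.single_le_sum (f := fun i => g i i) (fun i _ => h.g_nonneg i)
      (Finset.mem_range.2 hi)).trans (le_add_of_nonneg_left (h.f_nonneg m))
  · exact (h.g_le i).trans <| (mul_le_of_le_one_left (h.f_nonneg i)
      (pow_le_one₀ h.δ_nonneg h.δ_le_one)).trans <|
        (h.f_antitone (not_lt.1 hi)).trans (h.f_le_bulk m)

/-- Cauchy–Schwarz: one index at least `m` already yields the factor `δ`, however small the other
index is. -/
theorem abs_g_le_of_le_right (h : DissipativeGram f g δ) {m j : ℕ} (i : ℕ) (hj : m ≤ j) :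
    |g i j| ≤ δ * bulk f g m := by
  refine abs_le_of_sq_le_sq ?_ (mul_nonneg h.δ_nonneg (h.bulk_nonneg m))
  have hjj : g j j ≤ δ ^ 2 * bulk f g m :=
    (h.g_le j).trans (mul_le_mul_of_nonneg_left
      ((h.f_antitone hj).trans (h.f_le_bulk m)) (sq_nonneg δ))
  calc g i j ^ 2 ≤ g i i * g j j := h.g_sq_le i j
    _ ≤ bulk f g m * (δ ^ 2 * bulk f g m) :=
      mul_le_mul (h.g_diag_le_bulk m i) hjj (h.g_nonneg j) (h.bulk_nonneg m)
    _ = _ := by ring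

theorem g_symm (h : DissipativeGram f g δ) (i j : ℕ) : g i j = g j i := by
  have h1 := h.f_add i j
  have h2 := h.f_add j i
  rw [h.f_symm (j + 1) i, h.f_symm j (i + 1)] at h2
  linarith

theorem abs_g_le (h : DissipativeGram f g δ) {m i j : ℕ} (hij : m ≤ i ∨ m ≤ j) :
    |g i j| ≤ δ * bulk f g m := by
  rcases hij with hi | hj
  · rw [h.g_symm]
    exact h.abs_g_le_of_le_right j hi
  · exact h.abs_g_le_of_le_right i hj

theorem abs_f_le_of_le (h : DissipativeGram f g δ) {m i j : ℕ} (hi : m ≤ i) (hj : m + 1 ≤ j) :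
    |f i j| ≤ δ * bulk f g m := by
  refine abs_le_of_sq_le_sq ?_ (mul_nonneg h.δ_nonneg (h.bulk_nonneg m))
  have h1 : f i i ≤ bulk f g m := (h.f_antitone hi).trans (h.f_le_bulk m)
  have h2 : f j j ≤ δ ^ 2 * bulk f g m := by
    refine (h.f_antitone hj).trans ((h.f_succ_le m).trans ?_)
    exact mul_le_mul (pow_le_pow_of_le_one h.δ_nonneg h.δ_le_one (by norm_num)) (h.f_le_bulk m)
      (h.f_nonneg m) (sq_nonneg δ)
  calc f i j ^ 2 ≤ f i i * f j j := h.f_sq_le i j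
    _ ≤ bulk f g m * (δ ^ 2 * bulk f g m) := mul_le_mul h1 h2 (h.f_nonneg j) (h.bulk_nonneg m)
    _ = _ := by ring

/-- Powers of `D` are moved one by one from the second argument to the first until the first index
is `m`. The total degree keeps the second index at least `m`, so each move costs one small `g` term.
-/
theorem abs_f_le_of_add_eq (h : DissipativeGram f g δ) {m : ℕ} (t : ℕ) :
    ∀ i j, i + t = m → 2 * m < i + j → |f i j| ≤ ((t : ℝ) + 1) * (δ * bulk f g m) := by
  induction t with
  | zero =>
    intro i j hi hij
    simpa using h.abs_f_le_of_le (m := m) (i := i) (j := j) (by omega) (by omega)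
  | succ t ih =>
    intro i j hi hij
    obtain ⟨j, rfl⟩ : ∃ l, j = l + 1 := ⟨j - 1, by omega⟩
    have h1 := ih (i + 1) j (by omega) (by omega)
    have h2 := h.abs_g_le_of_le_right (m := m) (j := j) i (by omega)
    have h3 : f i (j + 1) = -f (i + 1) j - g i j := by linarith [h.f_add i j]
    rw [h3]
    refine (abs_sub _ _).trans ?_
    rw [abs_neg]
    push_cast
    linarith

theorem abs_f_le (h : DissipativeGram f g δ) {m i j : ℕ} (hij : 2 * m < i + j) :
    |f i j| ≤ ((m : ℝ) + 1) * (δ * bulk f g m) := by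
  wlog hle : i ≤ j generalizing i j
  · rw [h.f_symm]
    exact this (by omega) (by omega)
  by_cases hi : i < m
  · refine (h.abs_f_le_of_add_eq (m - i) i j (by omega) hij).trans ?_
    have := mul_nonneg h.δ_nonneg (h.bulk_nonneg m)
    gcongr
    omega
  · refine (h.abs_f_le_of_le (not_lt.1 hi) (by omega)).trans ?_
    have := mul_nonneg h.δ_nonneg (h.bulk_nonneg m)
    have hm : (0 : ℝ) ≤ m := m.cast_nonneg
    nlinarith

/-- The same shifting with total degree exactly `2m`: it ends on the diagonal at `f m m`, and every
move flips the sign. At `t = m` this decides the sign of the corners. -/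
theorem abs_f_sub_le (h : DissipativeGram f g δ) {m : ℕ} (t : ℕ) :
    ∀ i, i + t = m → |f i (m + t) - (-1) ^ t * f m m| ≤ (t : ℝ) * (δ * bulk f g m) := by
  induction t with
  | zero =>
    intro i hi
    obtain rfl : i = m := by omega
    simp
  | succ t ih =>
    intro i hi
    have h1 := ih (i + 1) (by omega)
    have h2 := h.abs_g_le_of_le_right (m := m) (j := m + t) i (by omega)
    have h3 : f i (m + t + 1) = -f (i + 1) (m + t) - g i (m + t) := by
      linarith [h.f_add i (m + t)]
    rw [← add_assoc, h3, show -f (i + 1) (m + t) - g i (m + t) - (-1) ^ (t + 1) * f m m =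
      -(f (i + 1) (m + t) - (-1) ^ t * f m m) - g i (m + t) by ring]
    refine (abs_sub _ _).trans ?_
    rw [abs_neg]
    push_cast
    linarith

/-- The triangle is summed by antidiagonals: degree `0` leaves `f 0 0`, and each higher degree turns
into dissipation. -/
theorem sum_ite_eq (h : DissipativeGram f g δ) (r : ℕ) :
    ∑ i ∈ Finset.range (r + 2), ∑ j ∈ Finset.range (r + 2),
        (if i + j < r + 2 then f i j / (i.factorial * j.factorial) else 0) =
      f 0 0 - ∑ i ∈ Finset.range (r + 1), ∑ j ∈ Finset.range (r + 1),
        (if i + j < r + 1 then g i j / (i.factorial * j.factorial * ((i + j : ℕ) + 1)) else 0) := by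
  rw [← sum_range_sum_antidiagonal (r + 2) (fun i j => f i j / (i.factorial * j.factorial)),
    ← sum_range_sum_antidiagonal (r + 1)
      (fun i j => g i j / (i.factorial * j.factorial * ((i + j : ℕ) + 1))),
    Finset.sum_range_succ', Finset.sum_congr rfl fun n _ => h.sum_antidiagonal_succ n,
    Finset.sum_neg_distrib]
  simp
  ring

/-- Energy decay for the truncated exponential of degree `r = 2 m - 1` with `m` even. -/
theorem sum_le (h : DissipativeGram f g δ) {r m : ℕ} (hr : r + 1 = 2 * m) (hm : Even m) {c : ℝ}
    (hc : c ≤ 2 / ((r + 1).factorial : ℝ))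
    (hg : c * ∑ i ∈ Finset.range m, g i i ≤ ∑ i ∈ Finset.range m, ∑ j ∈ Finset.range m,
      g i j / (i.factorial * j.factorial * ((i + j : ℕ) + 1)))
    (hδ : (2 * (m : ℝ) + ((r : ℝ) + 2) ^ 2 * ((m : ℝ) + 2)) * δ ≤ c) :
    ∑ i ∈ Finset.range (r + 1), ∑ j ∈ Finset.range (r + 1),
      f i j / (i.factorial * j.factorial) ≤ f 0 0 := by
  set Y := δ * bulk f g m with hY
  have hY0 : 0 ≤ Y := mul_nonneg h.δ_nonneg (h.bulk_nonneg m)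
  have hone : ∀ i : ℕ, (1 : ℝ) ≤ i.factorial := fun i => by exact_mod_cast i.factorial_pos
  have hw : ∀ i j : ℕ, (1 : ℝ) ≤ i.factorial * j.factorial := fun i j =>
    one_le_mul_of_one_le_of_one_le (hone i) (hone j)
  -- The square is padded by one row and one column so that it can be compared termwise with the
  -- triangle `i + j ≤ r + 1`.
  have hsub : ∀ F : ℕ → ℕ → ℝ, ∑ i ∈ Finset.range (r + 1), ∑ j ∈ Finset.range (r + 1), F i j =
      ∑ i ∈ Finset.range (r + 2), ∑ j ∈ Finset.range (r + 2),
        if i < r + 1 ∧ j < r + 1 then F i j else 0 := by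
    intro F
    have hz : ∀ i, (if r + 1 < r + 1 ∧ i < r + 1 then F (r + 1) i else 0) = 0 := fun i =>
      if_neg (by omega)
    have hz' : ∀ i, (if i < r + 1 ∧ r + 1 < r + 1 then F i (r + 1) else 0) = 0 := fun i =>
      if_neg (by omega)
    rw [Finset.sum_range_succ _ (r + 1), Finset.sum_eq_zero (fun i _ => hz i), add_zero]
    refine Finset.sum_congr rfl fun i hi => ?_
    rw [Finset.sum_range_succ _ (r + 1), hz' i, add_zero]
    refine Finset.sum_congr rfl fun j hj => ?_
    rw [if_pos ⟨Finset.mem_range.1 hi, Finset.mem_range.1 hj⟩]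
  have hcorner : ∀ a b : ℕ, a < r + 2 → b < r + 2 → ∀ F : ℕ → ℕ → ℝ,
      (∑ i ∈ Finset.range (r + 2), ∑ j ∈ Finset.range (r + 2),
        if i = a ∧ j = b then F i j else 0) = F a b := by
    intro a b ha hb F
    rw [Finset.sum_eq_single a, Finset.sum_eq_single b]
    · simp
    · intro j _ hj
      exact if_neg (by tauto)
    · intro hb'
      exact absurd (Finset.mem_range.2 hb) hb'
    · intro i _ hi
      exact Finset.sum_eq_zero fun j _ => if_neg (by tauto)
    · intro ha'
      exact absurd (Finset.mem_range.2 ha) ha'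
  let F : ℕ → ℕ → ℝ := fun i j => f i j / (i.factorial * j.factorial)
  let G : ℕ → ℕ → ℝ := fun i j => g i j / (i.factorial * j.factorial * ((i + j : ℕ) + 1))
  -- Square = triangle, minus its two corners, plus the entries of total degree above `2m = r + 1`.
  have split_f : ∑ i ∈ Finset.range (r + 1), ∑ j ∈ Finset.range (r + 1), F i j =
      (∑ i ∈ Finset.range (r + 2), ∑ j ∈ Finset.range (r + 2), if i + j < r + 2 then F i j else 0)
      - F 0 (r + 1) - F (r + 1) 0
      + ∑ i ∈ Finset.range (r + 2), ∑ j ∈ Finset.range (r + 2),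
          if 2 * m < i + j ∧ i < r + 1 ∧ j < r + 1 then F i j else 0 := by
    rw [hsub, ← hcorner 0 (r + 1) (by omega) (by omega) F,
      ← hcorner (r + 1) 0 (by omega) (by omega) F]
    simp only [← Finset.sum_sub_distrib, ← Finset.sum_add_distrib]
    refine Finset.sum_congr rfl fun i _ => Finset.sum_congr rfl fun j _ => ?_
    split_ifs <;> first | omega | ring
  -- The whole block `i, j < m` lies in the triangle, as `i + j ≤ 2m - 2 ≤ r`. The other entries
  -- have an index at least `m` and are small.
  have split_g : (∑ i ∈ Finset.range (r + 1), ∑ j ∈ Finset.range (r + 1),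
        if i + j < r + 1 then G i j else 0) =
      ∑ i ∈ Finset.range m, ∑ j ∈ Finset.range m, G i j
      + ∑ i ∈ Finset.range (r + 1), ∑ j ∈ Finset.range (r + 1),
          if i + j < r + 1 ∧ (m ≤ i ∨ m ≤ j) then G i j else 0 := by
    have e : ∑ i ∈ Finset.range m, ∑ j ∈ Finset.range m, G i j =
        ∑ i ∈ Finset.range (r + 1), ∑ j ∈ Finset.range (r + 1),
          if i < m ∧ j < m then G i j else 0 := by
      rw [← Finset.sum_product', ← Finset.sum_product'
        (f := fun i j => if i < m ∧ j < m then G i j else 0), ← Finset.sum_filter]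
      refine Finset.sum_congr ?_ fun _ _ => rfl
      ext p
      simp only [Finset.mem_product, Finset.mem_filter, Finset.mem_range]
      omega
    rw [e, ← Finset.sum_add_distrib]
    refine Finset.sum_congr rfl fun i _ => ?_
    rw [← Finset.sum_add_distrib]
    refine Finset.sum_congr rfl fun j _ => ?_
    split_ifs <;> first | omega | ring
  have hmain := h.sum_ite_eq r
  have hG : |∑ i ∈ Finset.range (r + 1), ∑ j ∈ Finset.range (r + 1),
      if i + j < r + 1 ∧ (m ≤ i ∨ m ≤ j) then G i j else 0| ≤ ((r + 1 : ℕ) : ℝ) ^ 2 * Y := by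
    refine abs_sum_sum_ite_le _ _ _ hY0 fun i j hij => ?_
    have hden : (1 : ℝ) ≤ i.factorial * j.factorial * ((i + j : ℕ) + 1) :=
      one_le_mul_of_one_le_of_one_le (hw i j) (by linarith [(i + j).cast_nonneg (α := ℝ)])
    simp only [G]
    rw [abs_div, abs_of_pos (a := (i.factorial : ℝ) * _ * _) (by linarith)]
    exact (div_le_self (abs_nonneg _) hden).trans (h.abs_g_le hij.2)
  have hF : |∑ i ∈ Finset.range (r + 2), ∑ j ∈ Finset.range (r + 2),
      if 2 * m < i + j ∧ i < r + 1 ∧ j < r + 1 then F i j else 0| ≤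
        ((r + 2 : ℕ) : ℝ) ^ 2 * (((m : ℝ) + 1) * Y) := by
    refine abs_sum_sum_ite_le _ _ _ (by positivity) fun i j hij => ?_
    simp only [F]
    rw [abs_div, abs_of_pos (a := (i.factorial : ℝ) * _) (by linarith [hw i j])]
    exact (div_le_self (abs_nonneg _) (hw i j)).trans (h.abs_f_le hij.1)
  -- The only use of `m` even: for odd `m` the corners would contribute with the destabilising sign.
  have hcorn : f m m - m * Y ≤ f 0 (r + 1) := by
    have := h.abs_f_sub_le (m := m) m 0 (by omega)
    rw [hm.neg_one_pow, one_mul, ← two_mul, ← hr] at this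
    linarith [(abs_le.1 this).1]
  have hfac : (1 : ℝ) ≤ (r + 1).factorial := hone _
  have hF1 : F 0 (r + 1) = f 0 (r + 1) / (r + 1).factorial := by simp [F]
  have hF2 : F (r + 1) 0 = f 0 (r + 1) / (r + 1).factorial := by
    simp only [F]
    rw [h.f_symm]
    simp
  have hcornF : c * f m m - 2 * m * Y ≤ F 0 (r + 1) + F (r + 1) 0 := by
    rw [hF1, hF2]
    have h1 : (f m m - m * Y) / (r + 1).factorial ≤ f 0 (r + 1) / (r + 1).factorial := by gcongr
    have h2 : m * Y / (r + 1).factorial ≤ m * Y :=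
      div_le_self (by positivity) hfac
    have h3 : c * f m m ≤ 2 / ((r + 1).factorial : ℝ) * f m m :=
      mul_le_mul_of_nonneg_right hc (h.f_nonneg m)
    have h4 : 2 / ((r + 1).factorial : ℝ) * f m m = 2 * (f m m / (r + 1).factorial) := by ring
    rw [sub_div] at h1
    linarith
  have hfin : (2 * (m : ℝ) + ((r : ℝ) + 2) ^ 2 * ((m : ℝ) + 2)) * Y ≤ c * bulk f g m := by
    rw [hY, ← mul_assoc]
    exact mul_le_mul_of_nonneg_right hδ (h.bulk_nonneg m)
  have hbulk : c * bulk f g m = c * f m m + c * ∑ i ∈ Finset.range m, g i i := by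
    rw [bulk, mul_add]
  have hsq : ((r + 1 : ℕ) : ℝ) ^ 2 * Y ≤ ((r : ℝ) + 2) ^ 2 * Y := by
    push_cast
    gcongr
    norm_num
  push_cast at hF
  change ∑ i ∈ Finset.range (r + 1), ∑ j ∈ Finset.range (r + 1), F i j ≤ f 0 0
  change _ = f 0 0 - ∑ i ∈ Finset.range (r + 1), ∑ j ∈ Finset.range (r + 1),
    (if i + j < r + 1 then G i j else 0) at hmain
  change (∑ i ∈ Finset.range (r + 2), ∑ j ∈ Finset.range (r + 2),
    if i + j < r + 2 then F i j else 0) = _ at hmain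
  change _ ≤ ∑ i ∈ Finset.range m, ∑ j ∈ Finset.range m, G i j at hg
  rw [split_f, hmain, split_g]
  have h5 := (abs_le.1 hG).1
  have h6 := (abs_le.1 hF).2
  have h7 : ((r : ℝ) + 2) ^ 2 * (((m : ℝ) + 1) * Y) + ((r : ℝ) + 2) ^ 2 * Y =
    ((r : ℝ) + 2) ^ 2 * ((m : ℝ) + 2) * Y := by ring
  rw [add_mul] at hfin
  linarith

end DissipativeGram

/-! ### The stability polynomial of an `r`-stage method of order `r`. -/

section Taylor

/-- One factor `X` at a time: after dividing by `z ^ n` the cofactor is `O(z)` on the punctured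
neighbourhood, hence vanishes at `0` by continuity. -/
theorem X_pow_dvd_of_isBigO {p : ℝ[X]} (n : ℕ)
    (h : (fun z : ℝ => p.eval z) =O[𝓝 0] fun z : ℝ => z ^ n) : X ^ n ∣ p := by
  induction n with
  | zero => simp
  | succ n ih =>
    have hle : (fun z : ℝ => z ^ (n + 1)) =O[𝓝 0] fun z : ℝ => z ^ n :=
      Asymptotics.IsBigO.of_bound 1 <| by
        filter_upwards [Metric.closedBall_mem_nhds (0 : ℝ) one_pos] with z hz
        rw [one_mul, norm_pow, norm_pow]
        exact pow_le_pow_of_le_one (norm_nonneg z) (by simpa using hz) n.le_succ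
    obtain ⟨q, rfl⟩ := ih (h.trans hle)
    obtain ⟨B, hB⟩ := h.bound
    have hq : ∀ᶠ z in 𝓝[≠] (0 : ℝ), |q.eval z| ≤ B * |z| := by
      filter_upwards [hB.filter_mono nhdsWithin_le_nhds, self_mem_nhdsWithin] with z hz hne
      have hz0 : 0 < |z| ^ n := pow_pos (abs_pos.2 hne) n
      rw [eval_mul, eval_pow, eval_X, norm_mul, norm_pow, norm_pow, Real.norm_eq_abs,
        Real.norm_eq_abs, pow_succ] at hz
      refine le_of_mul_le_mul_left ?_ hz0
      linarith
    have h1 : Filter.Tendsto (fun z : ℝ => |q.eval z|) (𝓝[≠] 0) (𝓝 |q.eval 0|) :=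
      (q.continuous.abs.tendsto 0).mono_left nhdsWithin_le_nhds
    have h2 : Filter.Tendsto (fun z : ℝ => B * |z|) (𝓝[≠] 0) (𝓝 0) := by
      have : Filter.Tendsto (fun z : ℝ => B * |z|) (𝓝 0) (𝓝 (B * |(0 : ℝ)|)) :=
        (continuous_const.mul continuous_abs).tendsto 0
      rw [abs_zero, mul_zero] at this
      exact this.mono_left nhdsWithin_le_nhds
    have h3 : |q.eval 0| ≤ 0 := le_of_tendsto_of_tendsto h1 h2 hq
    have h4 : q.eval 0 = 0 := abs_eq_zero.1 (le_antisymm h3 (abs_nonneg _))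
    rw [pow_succ]
    exact mul_dvd_mul_left _ (X_dvd_iff.2 (by rwa [coeff_zero_eq_eval_zero]))

/-- The Taylor polynomial of the exponential function. -/
noncomputable def expTaylor (r : ℕ) : ℝ[X] :=
  ∑ i ∈ Finset.range (r + 1), C (1 / (i.factorial : ℝ)) * X ^ i

theorem degree_expTaylor_lt (r : ℕ) : (expTaylor r).degree < (r + 1 : ℕ) := by
  refine (degree_sum_le _ _).trans_lt ((Finset.sup_lt_iff (WithBot.bot_lt_coe _)).2 fun i hi => ?_)
  exact (degree_C_mul_X_pow_le _ _).trans_lt (by exact_mod_cast Finset.mem_range.1 hi)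

theorem expTaylor_sub_exp_isBigO (r : ℕ) :
    (fun z : ℝ => (expTaylor r).eval z - Real.exp z) =O[𝓝 0] fun z : ℝ => z ^ (r + 1) := by
  refine Asymptotics.IsBigO.of_bound
    (((r + 1).succ : ℝ) / ((r + 1).factorial * (r + 1 : ℕ))) ?_
  filter_upwards [Metric.closedBall_mem_nhds (0 : ℝ) one_pos] with z hz
  have hz' : |z| ≤ 1 := by simpa using hz
  have h := Real.exp_bound hz' r.succ_pos
  rw [Real.norm_eq_abs, abs_sub_comm, norm_pow, Real.norm_eq_abs, mul_comm]
  refine le_trans (le_of_eq ?_) h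
  congr 2
  simp only [expTaylor, eval_finsetSum, eval_mul, eval_C, eval_pow, eval_X]
  exact Finset.sum_congr rfl fun i _ => by ring

/-- The polynomial `P` with `P(τ L) u` the stage `ℓ` of the method applied to `u' = L u`. -/
noncomputable def RKMethod.stagePoly {s : ℕ} (rk : RKMethod s) : ℕ → ℝ[X]
  | 0 => 1
  | ℓ + 1 => ∑ κ : Fin (ℓ + 1),
      (C (rk.c ℓ κ) * rk.stagePoly κ + C (rk.d ℓ κ) * X * rk.stagePoly κ)
decreasing_by all_goals exact κ.isLt

theorem RKMethod.stagePoly_succ {s : ℕ} (rk : RKMethod s) (ℓ : ℕ) :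
    rk.stagePoly (ℓ + 1) = ∑ κ ∈ Finset.range (ℓ + 1),
      (C (rk.c ℓ κ) * rk.stagePoly κ + C (rk.d ℓ κ) * X * rk.stagePoly κ) := by
  rw [RKMethod.stagePoly, Finset.sum_range]

theorem RKMethod.eval_stagePoly {s : ℕ} (rk : RKMethod s) (z : ℝ) (ℓ : ℕ) :
    (rk.stagePoly ℓ).eval z = rk.testStage z ℓ := by
  induction ℓ using Nat.strong_induction_on with
  | _ ℓ ih =>
    cases ℓ with
    | zero => simp [RKMethod.stagePoly, RKMethod.testStage]
    | succ ℓ =>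
      rw [RKMethod.stagePoly, RKMethod.testStage, eval_finsetSum]
      refine Finset.sum_congr rfl fun κ _ => ?_
      rw [eval_add, eval_mul, eval_mul, eval_mul, eval_C, eval_C, eval_X, ih κ κ.isLt]
      ring

theorem RKMethod.degree_stagePoly_le {s : ℕ} (rk : RKMethod s) (ℓ : ℕ) :
    (rk.stagePoly ℓ).degree ≤ ℓ := by
  induction ℓ using Nat.strong_induction_on with
  | _ ℓ ih =>
    cases ℓ with
    | zero =>
      rw [RKMethod.stagePoly]
      exact degree_one_le
    | succ ℓ =>
      rw [RKMethod.stagePoly]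
      refine degree_sum_le_of_forall_le fun κ => ?_
      have hκ : (rk.stagePoly κ).degree ≤ (ℓ : WithBot ℕ) :=
        (ih κ κ.isLt).trans (by exact_mod_cast Nat.lt_succ_iff.1 κ.isLt)
      refine (degree_add_le _ _).trans (max_le ?_ ?_)
      · rw [← smul_eq_C_mul]
        exact (degree_smul_le _ _).trans (hκ.trans (by exact_mod_cast ℓ.le_succ))
      · rw [mul_assoc, ← smul_eq_C_mul]
        refine (degree_smul_le _ _).trans ((degree_mul_le _ _).trans ?_)
        rw [Nat.cast_succ, add_comm]
        exact add_le_add hκ degree_X_le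
where degree_sum_le_of_forall_le {n : ℕ} {f : Fin n → ℝ[X]} {b : WithBot ℕ}
    (h : ∀ i, (f i).degree ≤ b) : (∑ i, f i).degree ≤ b :=
  (degree_sum_le _ _).trans (Finset.sup_le fun i _ => h i)

/-- An `r`-stage method of order `r` has the truncated exponential as stability polynomial. -/
theorem RKMethod.stagePoly_eq_expTaylor {r : ℕ} (rk : RKMethod r) (h : rk.HasOrder r) :
    rk.stagePoly r = expTaylor r := by
  rw [← sub_eq_zero]
  have hO : (fun z : ℝ => (rk.stagePoly r - expTaylor r).eval z) =O[𝓝 0]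
      fun z : ℝ => z ^ (r + 1) := by
    refine (Asymptotics.IsBigO.sub h (expTaylor_sub_exp_isBigO r)).congr_left fun z => ?_
    rw [eval_sub, rk.eval_stagePoly]
    ring
  -- The difference is divisible by `X ^ (r + 1)`, while `r` stages only reach degree `r`.
  refine eq_zero_of_dvd_of_degree_lt (X_pow_dvd_of_isBigO (r + 1) hO) ?_
  rw [degree_X_pow]
  refine (degree_sub_le _ _).trans_lt (max_lt ?_ (degree_expTaylor_lt r))
  exact (rk.degree_stagePoly_le r).trans_lt (by exact_mod_cast r.lt_succ_self)

end Taylor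

/-! ### Contractivity for dissipative operators and forms. -/

section Energy

variable {V : Type} [AddCommGroup V] [Module ℝ V]

/-- Formally the right side is `∫₀¹ J(∑ tⁱ dᵢ, ∑ tʲ dⱼ) dt`. Decomposing the Gram matrix of `J` into
rank one pieces `x xᵀ` reduces the bound to the scalar polynomials `∑ xᵢ tⁱ`. -/
theorem sum_sum_hilbert_ge {n : ℕ} {c : ℝ}
    (hc : ∀ p : ℝ[X], p.degree < n →
      c * ∑ i ∈ Finset.range n, p.coeff i ^ 2 ≤ unitIntegral (p ^ 2))
    (J : LinearMap.BilinForm ℝ V) (hs : J.IsSymm) (hJ : ∀ v, 0 ≤ J v v) (d : ℕ → V) :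
    c * ∑ i ∈ Finset.range n, J (d i) (d i) ≤
      ∑ i ∈ Finset.range n, ∑ j ∈ Finset.range n, J (d i) (d j) / ((i + j : ℕ) + 1) := by
  have hG : (Matrix.of fun i j : Fin n => J (d i) (d j)).PosSemidef := by
    refine .of_dotProduct_mulVec_nonneg ?_ fun x => ?_
    · ext i j
      simpa using hs.eq (d j) (d i)
    · have : star x ⬝ᵥ Matrix.mulVec (Matrix.of fun i j : Fin n => J (d i) (d j)) x =
          J (∑ i : Fin n, x i • d i) (∑ i : Fin n, x i • d i) := by
        simp only [dotProduct, Matrix.mulVec, map_sum, LinearMap.sum_apply, map_smul,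
          LinearMap.smul_apply, smul_eq_mul, Matrix.of_apply, Pi.star_apply, star_trivial,
          Finset.mul_sum]
        rw [Finset.sum_comm]
        exact Finset.sum_congr rfl fun i _ => Finset.sum_congr rfl fun j _ => by ring
      rw [this]
      exact hJ _
  obtain ⟨m, v, hv⟩ := Matrix.posSemidef_iff_eq_sum_vecMulVec.1 hG
  have hentry : ∀ i j : Fin n, J (d i) (d j) = ∑ l, v l i * v l j := by
    intro i j
    have := congrFun (congrFun hv i) j
    simpa [Matrix.sum_apply, Matrix.vecMulVec_apply] using this
  have hone : ∀ l, c * ∑ i : Fin n, v l i ^ 2 ≤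
      ∑ i : Fin n, ∑ j : Fin n, v l i * v l j / (((i + j : ℕ) : ℝ) + 1) := by
    intro l
    let p : ℝ[X] := ∑ i : Fin n, C (v l i) * X ^ (i : ℕ)
    have hcoeff : ∀ i : Fin n, p.coeff i = v l i := by
      intro i
      simp [p, finsetSum_coeff, coeff_X_pow, Fin.val_inj]
    have hdeg : p.degree < n := by
      refine (degree_sum_le _ _).trans_lt
        ((Finset.sup_lt_iff (WithBot.bot_lt_coe _)).2 fun i _ => ?_)
      exact (degree_C_mul_X_pow_le _ _).trans_lt (by exact_mod_cast i.2)
    have h := hc p hdeg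
    rw [Finset.sum_range] at h
    simp only [hcoeff] at h
    refine h.trans (le_of_eq ?_)
    simp only [p, sq, Finset.sum_mul_sum, map_sum]
    refine Finset.sum_congr rfl fun i _ => Finset.sum_congr rfl fun j _ => ?_
    rw [← smul_eq_C_mul, ← smul_eq_C_mul, smul_mul_smul_comm, map_smul, ← pow_add,
      unitIntegral_X_pow, smul_eq_mul]
    ring
  rw [Finset.sum_range, Finset.sum_range]
  simp only [Finset.sum_range, hentry]
  calc c * ∑ i : Fin n, ∑ l, v l i * v l i = ∑ l, c * ∑ i : Fin n, v l i ^ 2 := by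
        rw [Finset.sum_comm, Finset.mul_sum]
        simp only [sq]
    _ ≤ ∑ l, ∑ i : Fin n, ∑ j : Fin n, v l i * v l j / (((i + j : ℕ) : ℝ) + 1) :=
        Finset.sum_le_sum fun l _ => hone l
    _ = _ := by
      rw [Finset.sum_comm]
      refine Finset.sum_congr rfl fun i _ => ?_
      rw [Finset.sum_comm]
      exact Finset.sum_congr rfl fun j _ => by rw [Finset.sum_div]

/-- The truncated exponential of degree `r ≡ 3 (mod 4)` of a small dissipative operator is a
contraction. -/
theorem exists_energy_le {r : ℕ} (hr : r ≡ 3 [MOD 4]) :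
    ∃ δ : ℝ, 0 < δ ∧ ∀ {V : Type} [AddCommGroup V] [Module ℝ V]
      (S J : LinearMap.BilinForm ℝ V) (D : V →ₗ[ℝ] V),
      S.IsSymm → J.IsSymm → (∀ v, 0 ≤ S v v) → (∀ v, 0 ≤ J v v) →
      (∀ v w, S (D v) w + S v (D w) = -J v w) →
      (∀ v, S (D v) (D v) ≤ δ ^ 4 * S v v) → (∀ v, J v v ≤ δ ^ 2 * S v v) →
      ∀ u, S (aeval D (expTaylor r) u) (aeval D (expTaylor r) u) ≤ S u u := by
  obtain ⟨m, hm, hrm⟩ : ∃ m, Even m ∧ r + 1 = 2 * m := by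
    have hr' : r % 4 = 3 := hr
    exact ⟨(r + 1) / 2, by rw [Nat.even_iff]; omega, by omega⟩
  obtain ⟨c, hc, hpos⟩ := exists_coeff_sq_le_unitIntegral m
  have hfac : ∀ i : ℕ, (1 : ℝ) ≤ i.factorial := fun i => by exact_mod_cast i.factorial_pos
  -- The first bound pays for the weights `1/i!` in the dissipation block, the second for the two
  -- corners.
  set c' : ℝ := min (c / (m.factorial : ℝ) ^ 2) (2 / ((r + 1).factorial : ℝ)) with hc'
  have hc'0 : 0 < c' := lt_min (by have := hfac m; positivity) (by have := hfac (r + 1); positivity)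
  set A : ℝ := 2 * (m : ℝ) + ((r : ℝ) + 2) ^ 2 * ((m : ℝ) + 2) with hA
  have hA0 : 0 < A := by positivity
  refine ⟨min 1 (c' / A), lt_min one_pos (by positivity), ?_⟩
  intro V _ _ S J D hS hJ hS0 hJ0 hSJ hD hJD u
  set δ := min 1 (c' / A)
  have hδ0 : 0 < δ := lt_min one_pos (by positivity)
  have gram : DissipativeGram (fun i j => S ((D ^ i) u) ((D ^ j) u))
      (fun i j => J ((D ^ i) u) ((D ^ j) u)) δ :=
    { f_symm := fun i j => hS.eq _ _
      f_nonneg := fun i => hS0 _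
      g_nonneg := fun i => hJ0 _
      f_sq_le := fun i j => LinearMap.BilinForm.apply_sq_le_of_symm S hS0 ⟨hS.eq⟩ _ _
      g_sq_le := fun i j => LinearMap.BilinForm.apply_sq_le_of_symm J hJ0 ⟨hJ.eq⟩ _ _
      f_add := fun i j => by
        simp only [pow_succ', Module.End.mul_apply]
        exact hSJ _ _
      f_succ_le := fun i => by
        simp only [pow_succ', Module.End.mul_apply]
        simpa only [pow_succ'] using hD ((D ^ i) u)
      g_le := fun i => hJD _
      δ_nonneg := hδ0.le
      δ_le_one := min_le_left _ _ }
  have hilb : c' * ∑ i ∈ Finset.range m, J ((D ^ i) u) ((D ^ i) u) ≤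
      ∑ i ∈ Finset.range m, ∑ j ∈ Finset.range m,
        J ((D ^ i) u) ((D ^ j) u) / (i.factorial * j.factorial * ((i + j : ℕ) + 1)) := by
    -- The factorials are absorbed into the vectors, so that only the Hilbert weights remain.
    have h := sum_sum_hilbert_ge hpos J hJ hJ0 (fun i => (1 / (i.factorial : ℝ)) • (D ^ i) u)
    simp only [map_smul, LinearMap.smul_apply, smul_eq_mul] at h
    refine le_trans ?_ (h.trans (le_of_eq ?_))
    · rw [Finset.mul_sum, Finset.mul_sum]
      refine Finset.sum_le_sum fun i hi => ?_
      have hle : (i.factorial : ℝ) ≤ m.factorial := by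
        exact_mod_cast Nat.factorial_le (Finset.mem_range.1 hi).le
      have h1 := hfac i
      calc c' * J ((D ^ i) u) ((D ^ i) u)
          ≤ c / (i.factorial : ℝ) ^ 2 * J ((D ^ i) u) ((D ^ i) u) := by
            refine mul_le_mul_of_nonneg_right ((min_le_left _ _).trans ?_) (hJ0 _)
            gcongr
        _ = _ := by ring
    · refine Finset.sum_congr rfl fun i _ => Finset.sum_congr rfl fun j _ => ?_
      have h1 := hfac i
      have h2 := hfac j
      field_simp
  have hfin := gram.sum_le hrm hm (min_le_right _ _) hilb (by
    calc A * δ ≤ A * (c' / A) := by gcongr; exact min_le_right _ _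
      _ = c' := by field_simp)
  have haeval : aeval D (expTaylor r) u =
      ∑ i ∈ Finset.range (r + 1), (1 / (i.factorial : ℝ)) • (D ^ i) u := by
    simp only [expTaylor, map_sum, ← smul_eq_C_mul, map_smul, map_pow, aeval_X,
      LinearMap.sum_apply, LinearMap.smul_apply]
  rw [haeval]
  refine le_trans (le_of_eq ?_) hfin
  simp only [map_sum, LinearMap.sum_apply, map_smul, LinearMap.smul_apply, smul_eq_mul,
    Finset.mul_sum]
  rw [Finset.sum_comm]
  refine Finset.sum_congr rfl fun i _ => Finset.sum_congr rfl fun j _ => ?_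
  have h1 := hfac i
  have h2 := hfac j
  field_simp

/-- Stability of a Runge--Kutta step for a dissipative form `H` bounded by `Λ`. -/
theorem exists_step_stable {r : ℕ} (hr : r ≡ 3 [MOD 4]) (rk : RKMethod r) (hrk : rk.HasOrder r) :
    ∃ ε : ℝ, 0 < ε ∧ ∀ {V : Type} [AddCommGroup V] [Module ℝ V] [FiniteDimensional ℝ V]
      (S H : LinearMap.BilinForm ℝ V) (Λ τ : ℝ),
      S.IsSymm → (∀ v, v ≠ 0 → 0 < S v v) → (∀ v, H v v ≤ 0) →
      (∀ v w, H v w ^ 2 ≤ Λ ^ 2 * (S v v * S w w)) → 0 ≤ Λ → 0 < τ → τ * Λ ≤ ε →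
      ∀ U : ℕ → V, (∀ ℓ < r, ∀ w, S (U (ℓ + 1)) w =
        ∑ κ ∈ Finset.range (ℓ + 1), (rk.c ℓ κ * S (U κ) w + τ * rk.d ℓ κ * H (U κ) w)) →
      S (U r) (U r) ≤ S (U 0) (U 0) := by
  obtain ⟨δ, hδ, hmain⟩ := exists_energy_le hr
  -- The half is for the dissipation form, which is `-2 τ H v v` on the diagonal and so needs `2 τ Λ
  -- ≤ δ ^ 2`.
  refine ⟨δ ^ 2 / 2, by positivity, ?_⟩
  intro V _ _ _ S H Λ τ hS hpos hH hbound hΛ hτ hCFL U hU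
  have hS0 : ∀ v, 0 ≤ S v v := fun v => by
    by_cases hv : v = 0
    · simp [hv]
    · exact (hpos v hv).le
  have hdef : ∀ v, S v v = 0 ↔ v = 0 := fun v =>
    ⟨fun h => by_contra fun hv => (hpos v hv).ne' h, fun h => by simp [h]⟩
  have hnd : S.Nondegenerate := (LinearMap.BilinForm.nondegenerate_iff S hS0 ⟨hS.eq⟩).2 hdef
  have hext : ∀ x y : V, (∀ w, S x w = S y w) → x = y := fun x y h => by
    rw [← sub_eq_zero, ← hdef, LinearMap.BilinForm.sub_left, h, sub_self]
  let D : V →ₗ[ℝ] V := (S.toDual hnd).symm.toLinearMap ∘ₗ (τ • H)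
  have hD : ∀ v w, S (D v) w = τ * H v w := by
    intro v w
    rw [← LinearMap.BilinForm.toDual_def hnd]
    simp [D]
  have hτΛ : 0 ≤ τ * Λ := mul_nonneg hτ.le hΛ
  let J : LinearMap.BilinForm ℝ V := -(τ • (H + H.flip))
  have hJ : ∀ v w, J v w = -(τ * (H v w + H w v)) := fun v w => by
    simp only [J, LinearMap.neg_apply, LinearMap.smul_apply, LinearMap.add_apply, smul_eq_mul]
    rfl
  have key := hmain S J D hS
    ⟨fun v w => by rw [hJ, hJ, add_comm]⟩ hS0
    (fun v => by
      rw [hJ]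
      have := mul_nonpos_of_nonneg_of_nonpos hτ.le (hH v)
      linarith)
    (fun v w => by
      rw [hJ, hD, show S v (D w) = S (D w) v from hS.eq v (D w), hD]
      ring)
    (fun v => by
      -- The bound on `H` is tested with `w = D v`; one factor `S (D v) (D v)` then cancels.
      have h1 : S (D v) (D v) ^ 2 ≤ (τ * Λ) ^ 2 * S v v * S (D v) (D v) := by
        rw [hD v (D v), mul_pow]
        have := mul_le_mul_of_nonneg_left (hbound v (D v)) (sq_nonneg τ)
        rw [hD v (D v)] at this
        linarith
      have h2 : S (D v) (D v) ≤ (τ * Λ) ^ 2 * S v v := by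
        rcases (hS0 (D v)).eq_or_lt with h | h
        · rw [← h]
          exact mul_nonneg (sq_nonneg _) (hS0 v)
        · rw [sq (S (D v) (D v))] at h1
          exact le_of_mul_le_mul_right h1 h
      refine h2.trans (mul_le_mul_of_nonneg_right ?_ (hS0 v))
      calc (τ * Λ) ^ 2 ≤ (δ ^ 2 / 2) ^ 2 := by gcongr
        _ = δ ^ 4 / 4 := by ring
        _ ≤ δ ^ 4 := by linarith [pow_pos hδ 4])
    (fun v => by
      have h1 : |H v v| ≤ Λ * S v v := by
        refine abs_le_of_sq_le_sq ((hbound v v).trans (le_of_eq (by ring)))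
          (mul_nonneg hΛ (hS0 v))
      have h2 := mul_le_mul_of_nonneg_left (abs_le.1 h1).1 hτ.le
      have h3 := mul_le_mul_of_nonneg_right hCFL (hS0 v)
      rw [hJ]
      linarith)
    (U 0)
  have hstage : ∀ ℓ ≤ r, U ℓ = aeval D (rk.stagePoly ℓ) (U 0) := by
    intro ℓ
    induction ℓ using Nat.strong_induction_on with
    | _ ℓ ih =>
      intro hℓ
      cases ℓ with
      | zero => simp [RKMethod.stagePoly]
      | succ ℓ =>
        refine hext _ _ fun w => ?_
        rw [hU ℓ (by omega) w, rk.stagePoly_succ, map_sum, LinearMap.sum_apply, map_sum,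
          LinearMap.sum_apply]
        refine Finset.sum_congr rfl fun κ hκ => ?_
        have hκ' := Finset.mem_range.1 hκ
        rw [map_add, mul_assoc (C (rk.d ℓ κ)), ← smul_eq_C_mul, ← smul_eq_C_mul, map_smul, map_smul, map_mul,
          aeval_X, LinearMap.add_apply, LinearMap.smul_apply, LinearMap.smul_apply,
          Module.End.mul_apply, ← ih κ hκ' (by omega), LinearMap.BilinForm.add_left,
          LinearMap.BilinForm.smul_left, LinearMap.BilinForm.smul_left, hD]
        ring
  rw [hstage r le_rfl, rk.stagePoly_eq_expTaylor hrk]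
  exact key

end Energy

/-! ### Telescoping sums, antiderivatives and the finite element space. -/

theorem sum_ite_le_castSucc_sub (n : ℕ) (F : Fin (n + 1) → ℝ) (m : Fin (n + 1)) :
    ∑ j : Fin n, (if m ≤ j.castSucc then F j.succ - F j.castSucc else 0) =
      F (Fin.last n) - F m := by
  induction n with
  | zero =>
    obtain rfl : m = Fin.last 0 := Fin.fin_one_eq_zero m
    simp
  | succ n ih =>
    rw [Fin.sum_univ_castSucc]
    refine Fin.lastCases ?_ (fun m => ?_) m
    · rw [if_neg (by simp [Fin.last_le_iff, (Fin.castSucc_lt_last _).ne]),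
        Finset.sum_eq_zero fun j _ => if_neg ?_]
      · simp
      · simp [Fin.last_le_iff, (Fin.castSucc_lt_last _).ne]
    · rw [if_pos (Fin.castSucc_le_castSucc_iff.2 (Fin.le_last m)), Fin.succ_last]
      have h := ih (fun j => F j.castSucc) m
      simp only [Fin.castSucc_le_castSucc_iff, Fin.succ_castSucc]
      rw [h]
      ring

theorem exists_antiderivative {k : ℕ} {v : ℝ[X]} (hv : v.degree ≤ k) :
    ∃ V : ℝ[X], derivative V = v ∧ V.natDegree ≤ k + 1 := by
  refine ⟨∑ i ∈ Finset.range (k + 1), C (v.coeff i / ((i : ℝ) + 1)) * X ^ (i + 1), ?_, ?_⟩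
  · rw [derivative_sum]
    conv_rhs => rw [v.as_sum_range_C_mul_X_pow' (n := k + 1)
      (Nat.lt_succ_of_le (natDegree_le_of_degree_le hv))]
    refine Finset.sum_congr rfl fun i _ => ?_
    have : (i : ℝ) + 1 ≠ 0 := by positivity
    rw [derivative_C_mul_X_pow, Nat.add_sub_cancel]
    push_cast
    rw [div_mul_cancel₀ _ this]
  · refine natDegree_sum_le_of_forall_le _ _ fun i hi => (natDegree_C_mul_X_pow_le _ _).trans ?_
    have := Finset.mem_range.1 hi
    omega

theorem mem_space {N k : ℕ} {v : Fin N → ℝ[X]} :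
    v ∈ space N k ↔ ∀ i, (v i).degree ≤ (k : WithBot ℕ) := by
  simp [space, Submodule.mem_pi, mem_degreeLE]

instance (N k : ℕ) : FiniteDimensional ℝ (space N k) := by
  let φ : space N k →ₗ[ℝ] (Fin N → Fin (k + 1) → ℝ) :=
    LinearMap.pi fun i => LinearMap.pi fun j =>
      lcoeff ℝ j ∘ₗ LinearMap.proj i ∘ₗ (space N k).subtype
  refine Module.Finite.of_injective φ ?_
  rw [injective_iff_map_eq_zero]
  intro v hv
  ext i m
  by_cases hm : m < k + 1
  · exact congrFun (congrFun hv i) ⟨m, hm⟩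
  · exact coeff_eq_zero_of_degree_lt ((mem_space.1 v.2 i).trans_lt (by exact_mod_cast (by omega)))

/-! ### Cells, quadrature errors and the structure of `⟨·,·⟩_*`. -/

namespace Mesh

variable {N k : ℕ} (M : Mesh N k)

theorem cellSize_pos (i : Fin N) : 0 < M.cellSize i :=
  sub_pos.2 (M.face_strictMono i.castSucc_lt_succ)

/-- Transport of a polynomial from cell `i` to `[0, 1]`. -/
noncomputable def pull (i : Fin N) : ℝ[X] →ₐ[ℝ] ℝ[X] :=
  aeval (C (M.cellSize i) * X + C (M.face i.castSucc))

theorem eval_pull (i : Fin N) (p : ℝ[X]) (x : ℝ) :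
    (M.pull i p).eval x = p.eval (M.cellSize i * x + M.face i.castSucc) := by
  rw [show M.pull i p = p.comp (C (M.cellSize i) * X + C (M.face i.castSucc)) from rfl, eval_comp]
  simp

theorem eval_pull_zero (i : Fin N) (p : ℝ[X]) :
    (M.pull i p).eval 0 = p.eval (M.face i.castSucc) := by
  rw [eval_pull]
  simp

theorem eval_pull_one (i : Fin N) (p : ℝ[X]) :
    (M.pull i p).eval 1 = p.eval (M.face i.succ) := by
  rw [eval_pull, cellSize]
  congr 1
  ring

theorem derivative_pull (i : Fin N) (p : ℝ[X]) :
    derivative (M.pull i p) = M.cellSize i • M.pull i (derivative p) := by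
  rw [show M.pull i p = p.comp (C (M.cellSize i) * X + C (M.face i.castSucc)) from rfl,
    derivative_comp, smul_eq_C_mul]
  simp only [derivative_add, derivative_C_mul, derivative_X, derivative_C, mul_one, add_zero]
  rfl

theorem natDegree_pull (i : Fin N) (p : ℝ[X]) : (M.pull i p).natDegree = p.natDegree := by
  rw [show M.pull i p = p.comp (C (M.cellSize i) * X + C (M.face i.castSucc)) from rfl,
    natDegree_comp, natDegree_linear (M.cellSize_pos i).ne', mul_one]

theorem coeff_pull (i : Fin N) {p : ℝ[X]} {n : ℕ} (hp : p.degree ≤ n) :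
    (M.pull i p).coeff n = M.cellSize i ^ n * p.coeff n := by
  rcases (natDegree_le_of_degree_le hp).eq_or_lt with rfl | h
  · have hl := natDegree_linear (b := M.face i.castSucc) (M.cellSize_pos i).ne'
    have := coeff_comp_degree_mul_degree (p := p) (hl.trans_ne one_ne_zero)
    rw [hl, mul_one, leadingCoeff_linear (M.cellSize_pos i).ne'] at this
    rw [mul_comm]
    exact this
  · rw [coeff_eq_zero_of_natDegree_lt h,
      coeff_eq_zero_of_natDegree_lt ((M.natDegree_pull i p).trans_lt h), mul_zero]

theorem degree_pull_le (i : Fin N) {p : ℝ[X]} {n : ℕ} (hp : p.degree ≤ n) :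
    (M.pull i p).degree ≤ n :=
  natDegree_le_iff_degree_le.1 ((M.natDegree_pull i p).trans_le (natDegree_le_of_degree_le hp))

/-- Integration over cell `i`. -/
noncomputable def cellIntegral (i : Fin N) : ℝ[X] →ₗ[ℝ] ℝ :=
  M.cellSize i • unitIntegral ∘ₗ (M.pull i).toLinearMap

theorem cellIntegral_apply (i : Fin N) (p : ℝ[X]) :
    M.cellIntegral i p = M.cellSize i * unitIntegral (M.pull i p) := rfl

theorem cellIntegral_eq_integral (i : Fin N) (p : ℝ[X]) :
    M.cellIntegral i p = ∫ x in (M.face i.castSucc)..(M.face i.succ), p.eval x := by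
  rw [cellIntegral_apply, unitIntegral_apply]
  simp only [eval_pull]
  rw [intervalIntegral.integral_comp_mul_add (fun x => p.eval x) (M.cellSize_pos i).ne', smul_eq_mul,
    mul_inv_cancel_left₀ (M.cellSize_pos i).ne']
  simp [cellSize]

theorem cellIntegral_derivative (i : Fin N) (p : ℝ[X]) :
    M.cellIntegral i (derivative p) = p.eval (M.face i.succ) - p.eval (M.face i.castSucc) := by
  rw [cellIntegral_apply, ← smul_eq_mul, ← map_smul, ← derivative_pull, unitIntegral_derivative,
    eval_pull_one, eval_pull_zero]

theorem cellIntegral_mul_derivative (i : Fin N) (p q : ℝ[X]) :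
    M.cellIntegral i (p * derivative q) =
      unitIntegral (M.pull i p * derivative (M.pull i q)) := by
  rw [cellIntegral_apply, derivative_pull, mul_smul_comm, map_smul, map_mul, smul_eq_mul]

/-- The quadrature error `∫ p - Q_i(p)` on cell `i`. -/
noncomputable def quadError (i : Fin N) : ℝ[X] →ₗ[ℝ] ℝ :=
  M.cellIntegral i - ∑ j, M.weight i j • leval (M.node i j)

theorem quadError_apply (i : Fin N) (p : ℝ[X]) :
    M.quadError i p = M.cellIntegral i p - M.quad i (fun x => p.eval x) := by
  simp [quadError, quad, LinearMap.sum_apply]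

theorem Admissible.quadError_eq_zero {M : Mesh N k} (hM : M.Admissible) (i : Fin N) {p : ℝ[X]}
    (hp : p.degree < ((2 * k : ℕ) : WithBot ℕ)) : M.quadError i p = 0 := by
  rw [quadError_apply, cellIntegral_eq_integral, hM.1 i p hp, sub_self]

theorem Admissible.quad_eq {M : Mesh N k} (hM : M.Admissible) (i : Fin N) {p : ℝ[X]}
    (hp : p.degree < ((2 * k : ℕ) : WithBot ℕ)) :
    M.quad i (fun x => p.eval x) = M.cellIntegral i p := by
  have := hM.quadError_eq_zero i hp
  rw [quadError_apply] at this
  linarith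

/-- Exactness up to degree `2k - 1` leaves a single free number per cell, the error on `X ^ (2k)`.
-/
theorem Admissible.quadError_eq {M : Mesh N k} (hM : M.Admissible) (i : Fin N) {p : ℝ[X]}
    (hp : p.natDegree ≤ 2 * k) :
    M.quadError i p = p.coeff (2 * k) * M.quadError i (X ^ (2 * k)) := by
  have h : (p - p.coeff (2 * k) • X ^ (2 * k)).degree < ((2 * k : ℕ) : WithBot ℕ) := by
    refine (degree_lt_iff_coeff_zero _ _).2 fun m hm => ?_
    rw [coeff_sub, coeff_smul, coeff_X_pow, smul_eq_mul]
    rcases hm.eq_or_lt with rfl | hm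
    · simp
    · rw [if_neg hm.ne', coeff_eq_zero_of_natDegree_lt (hp.trans_lt hm)]
      simp
  have := hM.quadError_eq_zero i h
  rw [map_sub, map_smul, smul_eq_mul] at this
  linarith

/-- The correction of the `L²` product in `⟨·, ·⟩_*` coming from the highest mode on cell `i`. -/
noncomputable def massDefect (i : Fin N) : ℝ := (k : ℝ) / (k + 1) * M.quadError i (X ^ (2 * k))

theorem degree_derivative_lt_two_mul {w : ℝ[X]} (hw : w.degree ≤ k) :
    (derivative w).degree < ((2 * k : ℕ) : WithBot ℕ) := by
  refine (degree_lt_iff_coeff_zero _ _).2 fun m hm => ?_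
  rw [coeff_derivative, coeff_eq_zero_of_degree_lt
    (hw.trans_lt (by exact_mod_cast (by omega : k < m + 1))), zero_mul]

theorem degree_mul_derivative_lt {v w : ℝ[X]} (hv : v.degree ≤ k) (hw : w.degree ≤ k) :
    (v * derivative w).degree < ((2 * k : ℕ) : WithBot ℕ) := by
  rcases Nat.eq_zero_or_pos k with rfl | hk
  · have h := degree_derivative_lt_two_mul hw
    rw [mul_zero, Nat.cast_zero, ← not_le, zero_le_degree_iff, not_not] at h
    simp [h]
  · by_cases hz : v * derivative w = 0
    · rw [hz, degree_zero]
      exact WithBot.bot_lt_coe _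
    · rw [← natDegree_lt_iff_degree_lt hz]
      have h2 := natDegree_mul_le (p := v) (q := derivative w)
      have h3 := natDegree_derivative_le w
      have h4 := natDegree_le_of_degree_le hv
      have h5 := natDegree_le_of_degree_le hw
      omega

/-- Abel summation: the weight at node `m` enters all control volumes to its right, over which the
increments of `V` telescope. -/
theorem sum_mul_mstar (i : Fin N) (V w : ℝ[X]) (u : Fin N → ℝ[X]) (hu : u i = w) :
    ∑ j : Fin (k + 1), (V.eval (M.node i j.succ) - V.eval (M.node i j.castSucc)) * M.mstar u i j =
      w.eval (M.face i.castSucc) * (V.eval (M.face i.succ) - V.eval (M.face i.castSucc))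
      + (V.eval (M.face i.succ) * M.quad i (fun x => (derivative w).eval x)
        - M.quad i (fun x => (V * derivative w).eval x)) := by
  subst hu
  have htel := sum_ite_le_castSucc_sub (k + 1) (fun j => V.eval (M.node i j))
  have h1 : ∀ j : Fin (k + 1), M.mstar u i j = (u i).eval (M.face i.castSucc) +
      ∑ m, if m ≤ j.castSucc then M.weight i m * (derivative (u i)).eval (M.node i m) else 0 := by
    intro j
    rw [mstar, M.node_zero, ← Finset.sum_filter]
    congr 2
    ext m
    simp
  simp only [h1, mul_add, Finset.sum_add_distrib]
  congr 1
  · have h0 := htel 0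
    simp only [Fin.zero_le, if_true] at h0
    rw [← Finset.sum_mul, h0, M.node_zero, M.node_last, mul_comm]
  · simp only [Finset.mul_sum]
    rw [Finset.sum_comm]
    have h2 : ∀ m, ∑ j : Fin (k + 1), (V.eval (M.node i j.succ) - V.eval (M.node i j.castSucc)) *
        (if m ≤ j.castSucc then M.weight i m * (derivative (u i)).eval (M.node i m) else 0) =
        (V.eval (M.face i.succ) - V.eval (M.node i m)) *
          (M.weight i m * (derivative (u i)).eval (M.node i m)) := by
      intro m
      have hm := htel m
      rw [M.node_last] at hm
      rw [← hm, Finset.sum_mul]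
      refine Finset.sum_congr rfl fun j _ => ?_
      split_ifs <;> simp
    simp only [h2, quad, eval_mul, Finset.mul_sum]
    rw [← Finset.sum_sub_distrib]
    exact Finset.sum_congr rfl fun m _ => by ring

/-- On the finite element space `⟨·, ·⟩_*` is the `L²` product plus a rank one correction on every
cell, in particular it is symmetric. -/
theorem starInner_eq {M : Mesh N k} (hM : M.Admissible) {v w : Fin N → ℝ[X]} (hv : v ∈ space N k)
    (hw : w ∈ space N k) :
    M.starInner v w = ∑ i, (M.cellIntegral i (v i * w i) +
      M.massDefect i * ((v i).coeff k * (w i).coeff k)) := by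
  rw [mem_space] at hv hw
  rw [starInner, pairing]
  refine Finset.sum_congr rfl fun i _ => ?_
  obtain ⟨V, hV, hdeg⟩ := exists_antiderivative (hv i)
  have hint : ∀ a b : ℝ, ∫ x in a..b, (v i).eval x = V.eval b - V.eval a := fun a b => by
    rw [← hV]
    exact intervalIntegral.integral_eq_sub_of_hasDerivAt (fun x _ => V.hasDerivAt x)
      ((derivative V).continuous.intervalIntegrable _ _)
  simp only [hint]
  rw [M.sum_mul_mstar i V (w i) w rfl, hM.quad_eq i (degree_derivative_lt_two_mul (hw i)),
    cellIntegral_derivative]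
  have hparts : M.cellIntegral i (v i * w i) + M.cellIntegral i (V * derivative (w i)) =
      V.eval (M.face i.succ) * (w i).eval (M.face i.succ) -
        V.eval (M.face i.castSucc) * (w i).eval (M.face i.castSucc) := by
    rw [← map_add, ← hV, ← derivative_mul, cellIntegral_derivative, eval_mul, eval_mul]
  -- The leading coefficients of `V` and `w_x` are `v_k / (k + 1)` and `k w_k`, which explains the
  -- factor `k / (k + 1)` in `massDefect`. For `k = 0` both sides vanish.
  have hE : M.quadError i (V * derivative (w i)) =
      M.massDefect i * ((v i).coeff k * (w i).coeff k) := by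
    have hwd := natDegree_le_of_degree_le (hw i)
    rcases Nat.eq_zero_or_pos k with rfl | hk
    · have h0 : derivative (w i) = 0 := by
        have h := degree_derivative_lt_two_mul (hw i)
        rwa [mul_zero, Nat.cast_zero, ← not_le, zero_le_degree_iff, not_not] at h
      simp [h0, massDefect]
    · have hd' : (derivative (w i)).natDegree ≤ k - 1 :=
        (natDegree_derivative_le _).trans (by omega)
      rw [hM.quadError_eq i (natDegree_mul_le.trans (by omega)),
        show 2 * k = (k + 1) + (k - 1) by omega, coeff_mul_add_eq_of_natDegree_le hdeg hd',
        ← hV, coeff_derivative, coeff_derivative, show k - 1 + 1 = k by omega,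
        show k + 1 + (k - 1) = 2 * k by omega, massDefect]
      have hk1 : ((k - 1 : ℕ) : ℝ) + 1 = k := by
        rw [Nat.cast_sub hk]
        simp
      rw [hk1]
      have : (k : ℝ) + 1 ≠ 0 := by positivity
      field_simp
  rw [← hE, quadError_apply]
  linarith

end Mesh

/-! ### Inverse and trace inequalities. -/

/-- Inverse and trace inequalities on `[0, 1]`. -/
theorem exists_inverse_inequality (k : ℕ) :
    ∃ B : ℝ, 1 ≤ B ∧ ∀ p : ℝ[X], p.degree ≤ k →
      p.eval 0 ^ 2 ≤ B * unitIntegral (p ^ 2) ∧ p.eval 1 ^ 2 ≤ B * unitIntegral (p ^ 2) ∧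
        unitIntegral (derivative p ^ 2) ≤ B * unitIntegral (p ^ 2) := by
  obtain ⟨c, hc, hcoeff⟩ := exists_coeff_sq_le_unitIntegral (k + 1)
  have heval : ∀ q : ℝ[X], q.degree ≤ k → ∀ x ∈ Set.Icc (0 : ℝ) 1,
      q.eval x ^ 2 ≤ ((k : ℝ) + 1) * ∑ i ∈ Finset.range (k + 1), q.coeff i ^ 2 := by
    intro q hq x hx
    rw [eval_eq_sum_range' (Nat.lt_succ_of_le (natDegree_le_of_degree_le hq)), mul_comm]
    refine (Finset.sum_mul_sq_le_sq_mul_sq _ _ _).trans ?_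
    refine mul_le_mul_of_nonneg_left ?_ (Finset.sum_nonneg fun i _ => sq_nonneg _)
    calc ∑ i ∈ Finset.range (k + 1), (x ^ i) ^ 2 ≤ ∑ i ∈ Finset.range (k + 1), (1 : ℝ) :=
          Finset.sum_le_sum fun i _ => pow_le_one₀ (pow_nonneg hx.1 i) (pow_le_one₀ hx.1 hx.2)
      _ = _ := by simp
  have hder : ∀ p : ℝ[X], p.degree ≤ k →
      ∑ i ∈ Finset.range (k + 1), (derivative p).coeff i ^ 2 ≤
        ((k : ℝ) + 1) ^ 2 * ∑ i ∈ Finset.range (k + 1), p.coeff i ^ 2 := by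
    intro p hp
    have hlast : p.coeff (k + 1) = 0 :=
      coeff_eq_zero_of_degree_lt (hp.trans_lt (by exact_mod_cast k.lt_succ_self))
    have hshift : ∑ i ∈ Finset.range (k + 1), p.coeff (i + 1) ^ 2 ≤
        ∑ i ∈ Finset.range (k + 1), p.coeff i ^ 2 := by
      rw [Finset.sum_range_succ, hlast, Finset.sum_range_succ' (fun i => p.coeff i ^ 2)]
      have := sq_nonneg (p.coeff 0)
      linarith
    refine le_trans ?_ (mul_le_mul_of_nonneg_left hshift (sq_nonneg _))
    rw [Finset.mul_sum]
    refine Finset.sum_le_sum fun i hi => ?_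
    have hi' : (i : ℝ) ≤ k := by exact_mod_cast Nat.lt_succ_iff.1 (Finset.mem_range.1 hi)
    rw [coeff_derivative, mul_pow, mul_comm]
    gcongr
  set A : ℝ := ((k : ℝ) + 1) * ((k : ℝ) + 1) ^ 2 with hA
  have hk : (1 : ℝ) ≤ (k : ℝ) + 1 := by linarith [k.cast_nonneg (α := ℝ)]
  have hA1 : (k : ℝ) + 1 ≤ A := le_mul_of_one_le_right (by positivity) (one_le_pow₀ hk)
  refine ⟨max 1 (A / c), le_max_left _ _, fun p hp => ?_⟩
  have h0 := unitIntegral_sq_nonneg p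
  have hlt : p.degree < ((k + 1 : ℕ) : WithBot ℕ) :=
    hp.trans_lt (by exact_mod_cast k.lt_succ_self)
  set s := ∑ i ∈ Finset.range (k + 1), p.coeff i ^ 2 with hs
  have hs0 : 0 ≤ s := Finset.sum_nonneg fun i _ => sq_nonneg _
  have hsB : A * s ≤ max 1 (A / c) * unitIntegral (p ^ 2) := by
    calc A * s = A / c * (c * s) := by field_simp
      _ ≤ A / c * unitIntegral (p ^ 2) :=
        mul_le_mul_of_nonneg_left (hcoeff p hlt) (by positivity)
      _ ≤ _ := mul_le_mul_of_nonneg_right (le_max_right _ _) h0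
  have hks : ((k : ℝ) + 1) * s ≤ A * s := mul_le_mul_of_nonneg_right hA1 hs0
  refine ⟨((heval p hp 0 (by simp)).trans hks).trans hsB,
    ((heval p hp 1 (by simp)).trans hks).trans hsB, le_trans ?_ hsB⟩
  have hd : (derivative p).degree ≤ k := (degree_derivative_le).trans hp
  rw [unitIntegral_apply]
  calc ∫ x in (0 : ℝ)..1, (derivative p ^ 2).eval x ≤ ∫ _ in (0 : ℝ)..1, A * s := by
        refine intervalIntegral.integral_mono_on zero_le_one
          ((derivative p ^ 2).continuous.intervalIntegrable _ _) (by simp) fun x hx => ?_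
        rw [eval_pow]
        refine (heval _ hd x hx).trans ?_
        rw [hA, mul_assoc]
        exact mul_le_mul_of_nonneg_left (hder p hp) (by positivity)
    _ = A * s := by simp

/-! ### Coercivity of the energy product from the margin condition. -/

namespace Mesh

variable {N k : ℕ} (M : Mesh N k)

/-- The Legendre polynomial of a cell as a polynomial. -/
noncomputable def cellLegendre (i : Fin N) (l : ℕ) : ℝ[X] :=
  (unitLegendre l).comp (C (M.cellSize i)⁻¹ * (X - C (M.face i.castSucc)))

theorem eval_cellLegendre (i : Fin N) (l : ℕ) (x : ℝ) :
    (M.cellLegendre i l).eval x = M.legendre i l x := by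
  rw [cellLegendre, eval_comp, unitLegendre, legendre, eval_mul, eval_C, aeval_def, eval_map,
    algebraMap_int_eq]
  simp only [eval_mul, eval_C, eval_sub, eval_X]
  rw [inv_mul_eq_div]

theorem pull_cellLegendre (i : Fin N) (l : ℕ) : M.pull i (M.cellLegendre i l) = unitLegendre l := by
  rw [show M.pull i (M.cellLegendre i l) = (M.cellLegendre i l).comp
    (C (M.cellSize i) * X + C (M.face i.castSucc)) from rfl, cellLegendre, comp_assoc]
  simp only [mul_comp, sub_comp, C_comp, X_comp, add_sub_cancel_right]
  rw [← mul_assoc, ← C_mul, inv_mul_cancel₀ (M.cellSize_pos i).ne', C_1, one_mul, comp_X]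

theorem natDegree_cellLegendre_le (i : Fin N) (l : ℕ) : (M.cellLegendre i l).natDegree ≤ l := by
  rw [← M.natDegree_pull i, pull_cellLegendre]
  exact natDegree_le_of_degree_le (degree_unitLegendre_le l)

theorem pow_mul_coeff_cellLegendre (i : Fin N) (l : ℕ) :
    M.cellSize i ^ l * (M.cellLegendre i l).coeff l = l.centralBinom := by
  rw [← M.coeff_pull i (natDegree_le_iff_degree_le.1 (M.natDegree_cellLegendre_le i l)),
    pull_cellLegendre, coeff_unitLegendre_self]

/-- `L_{k+1}` and `L_{k-1}` are orthogonal, so minus their quadrature is a pure quadrature error in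
degree `2k`, fixed by the two leading coefficients. -/
theorem margin_eq {M : Mesh N k} (hM : M.Admissible) (hk : 1 ≤ k) (i : Fin N) :
    M.cellSize i ^ (2 * k) * (M.margin i - M.cellSize i / (2 * (k : ℝ) - 1)) =
      ((k + 1).centralBinom : ℝ) * ((k - 1).centralBinom : ℝ) *
        M.quadError i (X ^ (2 * k)) := by
  have horth : M.cellIntegral i (M.cellLegendre i (k + 1) * M.cellLegendre i (k - 1)) = 0 := by
    rw [cellIntegral_apply, map_mul, pull_cellLegendre, pull_cellLegendre, mul_comm (unitLegendre _),
      unitIntegral_mul_unitLegendre_of_degree_lt, mul_zero]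
    exact (degree_unitLegendre_le _).trans_lt (by exact_mod_cast (by omega : k - 1 < k + 1))
  have hE : M.margin i - M.cellSize i / (2 * (k : ℝ) - 1) =
      M.quadError i (M.cellLegendre i (k + 1) * M.cellLegendre i (k - 1)) := by
    rw [quadError_apply, horth, margin]
    simp only [eval_mul, eval_cellLegendre]
    ring
  have h1 := M.natDegree_cellLegendre_le i (k + 1)
  have h2 := M.natDegree_cellLegendre_le i (k - 1)
  rw [hE, hM.quadError_eq i (natDegree_mul_le.trans (by omega)),
    ← M.pow_mul_coeff_cellLegendre i (k + 1), ← M.pow_mul_coeff_cellLegendre i (k - 1),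
    show 2 * k = (k + 1) + (k - 1) by omega, coeff_mul_add_eq_of_natDegree_le h1 h2, pow_add]
  ring

/-- The energy form controls the `L²` norm on every cell. -/
theorem le_cellIntegral_add_massDefect {M : Mesh N k} (hM : M.Admissible) {ρ : ℝ}
    (hρ : 1 ≤ k → ∀ i, ρ * M.cellSize i ≤ M.margin i) (i : Fin N) {v : ℝ[X]} (hv : v.degree ≤ k) :
    min 1 ρ * M.cellIntegral i (v ^ 2) ≤
      M.cellIntegral i (v ^ 2) + M.massDefect i * (v.coeff k * v.coeff k) := by
  have hh := M.cellSize_pos i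
  have hint : 0 ≤ unitIntegral (M.pull i v ^ 2) := unitIntegral_sq_nonneg _
  rw [cellIntegral_apply, map_pow]
  rcases Nat.eq_zero_or_pos k with rfl | hk
  · rw [massDefect, Nat.cast_zero, zero_div, zero_mul, zero_mul, add_zero]
    exact mul_le_of_le_one_left (mul_nonneg hh.le hint) (min_le_left _ _)
  have hk1 : (1 : ℝ) ≤ k := by exact_mod_cast hk
  set W := (M.pull i v).coeff k ^ 2 / ((2 * (k : ℝ) + 1) * (k.centralBinom : ℝ) ^ 2) with hW
  have hW0 : 0 ≤ W := by positivity
  have hWle : W ≤ unitIntegral (M.pull i v ^ 2) := coeff_sq_div_le_unitIntegral (M.degree_pull_le i hv)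
  -- `cellSize * W` is the `L²` energy of the top Legendre mode; the correction replaces its weight
  -- by `(2k - 1) * margin`.
  have hid : M.massDefect i * (v.coeff k * v.coeff k) =
      ((2 * k - 1) * M.margin i - M.cellSize i) * W := by
    have h1 := margin_eq hM hk i
    have h2 := centralBinom_mul_centralBinom hk
    have hc : (k.centralBinom : ℝ) ≠ 0 := by exact_mod_cast k.centralBinom_ne_zero
    have hc1 : ((k + 1).centralBinom : ℝ) ≠ 0 := by exact_mod_cast (k + 1).centralBinom_ne_zero
    have hc2 : ((k - 1).centralBinom : ℝ) ≠ 0 := by exact_mod_cast (k - 1).centralBinom_ne_zero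
    have h2k : (2 * (k : ℝ) - 1) ≠ 0 := by linarith
    have hkk : (k : ℝ) ≠ 0 := by linarith
    have hkk1 : (k : ℝ) + 1 ≠ 0 := by linarith
    have h2k1 : 2 * (k : ℝ) + 1 ≠ 0 := by linarith
    rw [hW, M.coeff_pull i hv]
    generalize 2 * (k : ℝ) - 1 = d at *
    have h3 : M.quadError i (X ^ (2 * k)) =
        M.cellSize i ^ (2 * k) * (M.margin i - M.cellSize i / d) /
          (((k + 1).centralBinom : ℝ) * ((k - 1).centralBinom : ℝ)) := by
      rw [h1]
      field_simp
    have h4 : ((k + 1).centralBinom : ℝ) * ((k - 1).centralBinom : ℝ) =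
        (k.centralBinom : ℝ) ^ 2 * ((2 * k + 1) * k) / (((k : ℝ) + 1) * d) := by
      rw [← h2]
      field_simp
    rw [massDefect, h3, h4]
    field_simp
    ring
  -- Uses `2k - 1 ≥ 1` and the positivity of the margin.
  have hlow : (min 1 ρ - 1) * M.cellSize i ≤ (2 * k - 1) * M.margin i - M.cellSize i := by
    have h1 := hρ hk i
    have h2 := hM.2 hk i
    have h3 : min 1 ρ * M.cellSize i ≤ ρ * M.cellSize i :=
      mul_le_mul_of_nonneg_right (min_le_right _ _) hh.le
    nlinarith
  have h5 := mul_le_mul_of_nonneg_right hlow hW0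
  have h6 : (1 - min 1 ρ) * M.cellSize i * W ≤
      (1 - min 1 ρ) * M.cellSize i * unitIntegral (M.pull i v ^ 2) :=
    mul_le_mul_of_nonneg_left hWle
      (mul_nonneg (sub_nonneg.2 (min_le_left _ _)) hh.le)
  rw [hid]
  nlinarith

/-! ### Dissipation and boundedness of the spectral volume form. -/

/-- The upwind condition removes the last sum, and `v w_x` has degree at most `2k - 1`, so the
quadrature is exact. -/
theorem svForm_eq [NeZero N] {M : Mesh N k} (hM : M.Admissible) (hup : M.Upwind) (β : ℝ)
    {v w : Fin N → ℝ[X]} (hv : v ∈ space N k) (hw : w ∈ space N k) :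
    M.svForm β v w = β * (∑ i, M.cellIntegral i (v i * derivative (w i))
      + ∑ i, M.traceLeft v i * M.jump w i) := by
  rw [mem_space] at hv hw
  rw [svForm, Finset.sum_eq_zero (s := Finset.univ)
    (f := fun i => M.weight (i + 1) 0 * _ * M.jump v i) fun i _ => by rw [hup]; ring, sub_zero]
  congr 2
  refine Finset.sum_congr rfl fun i _ => ?_
  rw [← hM.quad_eq i (degree_mul_derivative_lt (hv i) (hw i))]
  simp only [eval_mul]

theorem sum_shift [NeZero N] (f : Fin N → ℝ) : ∑ i, f (i + 1) = ∑ i, f i :=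
  Equiv.sum_comp (Equiv.addRight (1 : Fin N)) f

/-- Upwinding dissipates energy. -/
theorem svForm_self_nonpos [NeZero N] {M : Mesh N k} (hM : M.Admissible) (hup : M.Upwind) {β : ℝ}
    (hβ : 0 ≤ β) {v : Fin N → ℝ[X]} (hv : v ∈ space N k) : M.svForm β v v ≤ 0 := by
  rw [svForm_eq hM hup β hv hv]
  refine mul_nonpos_of_nonneg_of_nonpos hβ ?_
  have h1 : ∀ i, M.cellIntegral i (v i * derivative (v i)) =
      (M.traceLeft v i ^ 2 - (v i).eval (M.face i.castSucc) ^ 2) / 2 := by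
    intro i
    have h := M.cellIntegral_derivative i (v i * v i)
    rw [derivative_mul, mul_comm (derivative (v i)), ← two_mul, ← map_ofNat C 2, ← smul_eq_C_mul,
      map_smul, smul_eq_mul, eval_mul, eval_mul] at h
    rw [traceLeft]
    linarith
  have h2 : ∑ i, (v i).eval (M.face i.castSucc) ^ 2 = ∑ i, M.traceRight v i ^ 2 :=
    (sum_shift fun i => (v i).eval (M.face i.castSucc) ^ 2).symm
  have h3 : ∑ i, M.cellIntegral i (v i * derivative (v i)) =
      ∑ i, (M.traceLeft v i ^ 2 - M.traceRight v i ^ 2) / 2 := by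
    simp only [h1]
    rw [← Finset.sum_div, ← Finset.sum_div, Finset.sum_sub_distrib, Finset.sum_sub_distrib, h2]
  rw [h3, ← Finset.sum_add_distrib]
  refine Finset.sum_nonpos fun i _ => ?_
  -- Each interface contributes minus half the squared jump.
  rw [jump]
  nlinarith [sq_nonneg (M.traceRight v i - M.traceLeft v i)]

theorem sum_mul_sq_le_of_le {f a b : Fin N → ℝ} {D : ℝ}
    (hf : ∀ i, |f i| ≤ D * (Real.sqrt (a i) * Real.sqrt (b i))) (hD : 0 ≤ D) (ha : ∀ i, 0 ≤ a i)
    (hb : ∀ i, 0 ≤ b i) :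
    |∑ i, f i| ≤ D * (Real.sqrt (∑ i, a i) * Real.sqrt (∑ i, b i)) := by
  calc |∑ i, f i| ≤ ∑ i, D * (Real.sqrt (a i) * Real.sqrt (b i)) :=
        (Finset.abs_sum_le_sum_abs _ _).trans (Finset.sum_le_sum fun i _ => hf i)
    _ = D * ∑ i, Real.sqrt (a i) * Real.sqrt (b i) := (Finset.mul_sum _ _ _).symm
    _ ≤ _ := mul_le_mul_of_nonneg_left
        (Real.sum_sqrt_mul_sqrt_le _ ha hb) hD

theorem abs_mul_le_sqrt {x y a b B : ℝ} (hB : 0 ≤ B) (hx : x ^ 2 ≤ B * a) (hy : y ^ 2 ≤ B * b) :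
    |x * y| ≤ B * (Real.sqrt a * Real.sqrt b) := by
  have h1 : |x| ≤ Real.sqrt B * Real.sqrt a := by
    rw [← Real.sqrt_mul hB]
    exact Real.abs_le_sqrt hx
  have h2 : |y| ≤ Real.sqrt B * Real.sqrt b := by
    rw [← Real.sqrt_mul hB]
    exact Real.abs_le_sqrt hy
  rw [abs_mul]
  calc |x| * |y| ≤ (Real.sqrt B * Real.sqrt a) * (Real.sqrt B * Real.sqrt b) :=
        mul_le_mul h1 h2 (abs_nonneg _) (by positivity)
    _ = (Real.sqrt B * Real.sqrt B) * (Real.sqrt a * Real.sqrt b) := by ring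
    _ = _ := by rw [Real.mul_self_sqrt hB]

/-- Volume terms and traces are scale invariant after transport to `[0, 1]`, so no power of the cell
size appears here. The factor `3` counts the volume sum and the two trace sums. -/
theorem abs_svForm_le [NeZero N] {M : Mesh N k} (hM : M.Admissible) (hup : M.Upwind) {β B : ℝ}
    (hβ : 0 ≤ β) (hB : 1 ≤ B) (hinv : ∀ p : ℝ[X], p.degree ≤ k →
      p.eval 0 ^ 2 ≤ B * unitIntegral (p ^ 2) ∧ p.eval 1 ^ 2 ≤ B * unitIntegral (p ^ 2) ∧
        unitIntegral (derivative p ^ 2) ≤ B * unitIntegral (p ^ 2))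
    {v w : Fin N → ℝ[X]} (hv : v ∈ space N k) (hw : w ∈ space N k) :
    |M.svForm β v w| ≤ 3 * β * B * (Real.sqrt (∑ i, unitIntegral (M.pull i (v i) ^ 2)) *
      Real.sqrt (∑ i, unitIntegral (M.pull i (w i) ^ 2))) := by
  have hB0 : 0 ≤ B := zero_le_one.trans hB
  set a : Fin N → ℝ := fun i => unitIntegral (M.pull i (v i) ^ 2) with ha
  set b : Fin N → ℝ := fun i => unitIntegral (M.pull i (w i) ^ 2) with hb
  have ha0 : ∀ i, 0 ≤ a i := fun i => unitIntegral_sq_nonneg _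
  have hb0 : ∀ i, 0 ≤ b i := fun i => unitIntegral_sq_nonneg _
  have hv' := fun i => hinv _ (M.degree_pull_le i (mem_space.1 hv i))
  have hw' := fun i => hinv _ (M.degree_pull_le i (mem_space.1 hw i))
  have h1 : |∑ i, M.cellIntegral i (v i * derivative (w i))| ≤
      B * (Real.sqrt (∑ i, a i) * Real.sqrt (∑ i, b i)) := by
    refine sum_mul_sq_le_of_le (fun i => ?_) hB0 ha0 hb0
    rw [cellIntegral_mul_derivative]
    refine abs_le_of_sq_le_sq ?_ (by positivity)
    calc _ ≤ a i * unitIntegral (derivative (M.pull i (w i)) ^ 2) :=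
          unitIntegral_cauchy_schwarz _ _
      _ ≤ a i * (B * b i) := mul_le_mul_of_nonneg_left (hw' i).2.2 (ha0 i)
      _ ≤ a i * (B * B * b i) := by
          refine mul_le_mul_of_nonneg_left ?_ (ha0 i)
          exact mul_le_mul_of_nonneg_right (le_mul_of_one_le_left hB0 hB) (hb0 i)
      _ = _ := by
          rw [mul_pow, mul_pow, Real.sq_sqrt (ha0 i), Real.sq_sqrt (hb0 i)]
          ring
  have h2 : |∑ i, M.traceLeft v i * M.traceRight w i| ≤
      B * (Real.sqrt (∑ i, a i) * Real.sqrt (∑ i, b i)) := by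
    -- The right trace lives in the next cell; periodicity allows the norm of `w` to be summed with
    -- shifted indices.
    rw [← sum_shift b]
    refine sum_mul_sq_le_of_le (fun i => ?_) hB0 ha0 (fun i => hb0 _)
    refine abs_mul_le_sqrt hB0 ?_ ?_
    · rw [traceLeft, ← eval_pull_one]
      exact (hv' i).2.1
    · rw [traceRight, ← eval_pull_zero]
      exact (hw' (i + 1)).1
  have h3 : |∑ i, M.traceLeft v i * M.traceLeft w i| ≤
      B * (Real.sqrt (∑ i, a i) * Real.sqrt (∑ i, b i)) := by
    refine sum_mul_sq_le_of_le (fun i => ?_) hB0 ha0 hb0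
    refine abs_mul_le_sqrt hB0 ?_ ?_
    · rw [traceLeft, ← eval_pull_one]
      exact (hv' i).2.1
    · rw [traceLeft, ← eval_pull_one]
      exact (hw' i).2.1
  rw [svForm_eq hM hup β hv hw, abs_mul, abs_of_nonneg hβ]
  simp only [jump, mul_sub, Finset.sum_sub_distrib]
  have h4 := abs_add_le (∑ i, M.cellIntegral i (v i * derivative (w i)))
    (∑ i, M.traceLeft v i * M.traceRight w i - ∑ i, M.traceLeft v i * M.traceLeft w i)
  have h5 := abs_sub (∑ i, M.traceLeft v i * M.traceRight w i)
    (∑ i, M.traceLeft v i * M.traceLeft w i)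
  calc _ ≤ β * (3 * (B * (Real.sqrt (∑ i, a i) * Real.sqrt (∑ i, b i)))) :=
        mul_le_mul_of_nonneg_left (by linarith) hβ
    _ = _ := by ring

/-! ### The bilinear forms on the finite element space and their scaling in `h`. -/

theorem cellSize_le_meshSize (i : Fin N) : M.cellSize i ≤ M.meshSize :=
  le_ciSup (Set.finite_range M.cellSize).bddAbove i

theorem meshSize_pos [NeZero N] : 0 < M.meshSize :=
  (M.cellSize_pos 0).trans_le (M.cellSize_le_meshSize 0)

/-- The form `⟨·, ·⟩_*` as a bilinear form on the finite element space. -/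
noncomputable def massForm : LinearMap.BilinForm ℝ (space N k) :=
  LinearMap.mk₂ ℝ (fun v w => ∑ i, (M.cellIntegral i (v.1 i * w.1 i) +
      M.massDefect i * ((v.1 i).coeff k * (w.1 i).coeff k)))
    (fun v v' w => by
      rw [← Finset.sum_add_distrib]
      refine Finset.sum_congr rfl fun i _ => ?_
      simp only [Submodule.coe_add, Pi.add_apply, add_mul, map_add, coeff_add]
      ring)
    (fun c v w => by
      rw [smul_eq_mul, Finset.mul_sum]
      refine Finset.sum_congr rfl fun i _ => ?_
      simp only [Submodule.coe_smul, Pi.smul_apply, smul_mul_assoc, map_smul, coeff_smul,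
        smul_eq_mul]
      ring)
    (fun v w w' => by
      rw [← Finset.sum_add_distrib]
      refine Finset.sum_congr rfl fun i _ => ?_
      simp only [Submodule.coe_add, Pi.add_apply, mul_add, map_add, coeff_add]
      ring)
    (fun c v w => by
      rw [smul_eq_mul, Finset.mul_sum]
      refine Finset.sum_congr rfl fun i _ => ?_
      simp only [Submodule.coe_smul, Pi.smul_apply, mul_smul_comm, map_smul, coeff_smul,
        smul_eq_mul]
      ring)

theorem massForm_apply {M : Mesh N k} (hM : M.Admissible) (v w : space N k) :
    M.massForm v w = M.starInner v w :=
  (starInner_eq hM v.2 w.2).symm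

theorem massForm_isSymm : M.massForm.IsSymm :=
  ⟨fun v w => by
    simp only [massForm, LinearMap.mk₂_apply]
    refine Finset.sum_congr rfl fun i _ => ?_
    rw [mul_comm (v.1 i), mul_comm ((v.1 i).coeff k)]⟩

/-- The spectral volume form as a bilinear form on the finite element space. -/
noncomputable def advectionForm [NeZero N] (β : ℝ) : LinearMap.BilinForm ℝ (space N k) :=
  LinearMap.mk₂ ℝ (fun v w => M.svForm β v w)
    (fun v v' w => by
      simp only [svForm, quad, traceLeft, traceRight, jump, Submodule.coe_add, Pi.add_apply,
        eval_add, ← mul_add]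
      simp only [← Finset.sum_add_distrib, ← Finset.sum_sub_distrib]
      congr 1
      refine Finset.sum_congr rfl fun i _ => ?_
      simp only [add_mul, mul_add, Finset.sum_add_distrib]
      ring)
    (fun c v w => by
      simp only [svForm, quad, traceLeft, traceRight, jump, Submodule.coe_smul, Pi.smul_apply,
        eval_smul, smul_eq_mul, mul_left_comm c β]
      simp only [← Finset.sum_add_distrib, ← Finset.sum_sub_distrib]
      congr 1
      rw [Finset.mul_sum]
      refine Finset.sum_congr rfl fun i _ => ?_
      simp only [mul_assoc, mul_left_comm _ c, ← Finset.mul_sum]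
      ring)
    (fun v w w' => by
      simp only [svForm, quad, traceLeft, traceRight, jump, Submodule.coe_add, Pi.add_apply,
        eval_add, map_add, ← mul_add]
      simp only [← Finset.sum_add_distrib, ← Finset.sum_sub_distrib]
      congr 1
      refine Finset.sum_congr rfl fun i _ => ?_
      simp only [mul_add, Finset.sum_add_distrib]
      ring)
    (fun c v w => by
      simp only [svForm, quad, traceLeft, traceRight, jump, Submodule.coe_smul, Pi.smul_apply,
        eval_smul, derivative_smul, smul_eq_mul, mul_left_comm c β]
      simp only [← Finset.sum_add_distrib, ← Finset.sum_sub_distrib]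
      congr 1
      rw [Finset.mul_sum]
      refine Finset.sum_congr rfl fun i _ => ?_
      simp only [mul_left_comm _ c, ← Finset.mul_sum]
      ring)

theorem advectionForm_apply [NeZero N] (β : ℝ) (v w : space N k) :
    M.advectionForm β v w = M.svForm β v w := rfl

theorem sum_cellIntegral_le_massForm {M : Mesh N k} (hM : M.Admissible) {ρ : ℝ}
    (hρ : 1 ≤ k → ∀ i, ρ * M.cellSize i ≤ M.margin i) (v : space N k) :
    min 1 ρ * ∑ i, M.cellIntegral i (v.1 i ^ 2) ≤ M.massForm v v := by
  rw [Finset.mul_sum]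
  refine Finset.sum_le_sum fun i _ => ?_
  rw [← sq (v.1 i)]
  exact le_cellIntegral_add_massDefect hM hρ i (mem_space.1 v.2 i)

theorem massForm_pos {M : Mesh N k} (hM : M.Admissible) {ρ : ℝ} (hρ0 : 0 < ρ)
    (hρ : 1 ≤ k → ∀ i, ρ * M.cellSize i ≤ M.margin i) {v : space N k} (hv : v ≠ 0) :
    0 < M.massForm v v := by
  refine lt_of_lt_of_le (mul_pos (lt_min one_pos hρ0) ?_) (sum_cellIntegral_le_massForm hM hρ v)
  obtain ⟨i, hi⟩ : ∃ i, v.1 i ≠ 0 := by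
    by_contra! h
    exact hv (Subtype.ext (funext h))
  have hnn : ∀ j, 0 ≤ M.cellIntegral j (v.1 j ^ 2) := fun j => by
    rw [cellIntegral_apply, map_pow]
    exact mul_nonneg (M.cellSize_pos j).le (unitIntegral_sq_nonneg _)
  refine Finset.sum_pos' (fun j _ => hnn j) ⟨i, Finset.mem_univ i, ?_⟩
  rw [cellIntegral_apply, map_pow]
  refine mul_pos (M.cellSize_pos i) (unitIntegral_sq_pos fun h0 => hi ?_)
  refine eq_zero_of_infinite_isRoot _ ((Set.infinite_univ (α := ℝ)).mono fun x _ => ?_)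
  have h := congrArg (eval ((x - M.face i.castSucc) / M.cellSize i)) h0
  rw [eval_pull, eval_zero, mul_div_cancel₀ _ (M.cellSize_pos i).ne', sub_add_cancel] at h
  exact h

/-- Returning from the unit cell to cell `i` costs `1 / h_i ≤ K / h`. This is the only source of the
factor `1 / h` in the operator bound, hence of the CFL condition. -/
theorem sum_unitIntegral_le_massForm [NeZero N] {M : Mesh N k} (hM : M.Admissible) {ρ K : ℝ}
    (hρ0 : 0 < ρ) (hρ : 1 ≤ k → ∀ i, ρ * M.cellSize i ≤ M.margin i)
    (hK : ∀ i, M.meshSize ≤ K * M.cellSize i) (hK0 : 0 < K) (v : space N k) :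
    ∑ i, unitIntegral (M.pull i (v.1 i) ^ 2) ≤
      K / (M.meshSize * min 1 ρ) * M.massForm v v := by
  have hh := M.meshSize_pos
  have hμ : 0 < min 1 ρ := lt_min one_pos hρ0
  have h1 : M.meshSize * ∑ i, unitIntegral (M.pull i (v.1 i) ^ 2) ≤
      K * ∑ i, M.cellIntegral i (v.1 i ^ 2) := by
    rw [Finset.mul_sum, Finset.mul_sum]
    refine Finset.sum_le_sum fun i _ => ?_
    rw [cellIntegral_apply, map_pow (M.pull i), ← mul_assoc]
    exact mul_le_mul_of_nonneg_right (hK i) (unitIntegral_sq_nonneg _)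
  have h2 := sum_cellIntegral_le_massForm hM hρ v
  have h3 := mul_le_mul_of_nonneg_left h1 hμ.le
  have h4 := mul_le_mul_of_nonneg_left h2 hK0.le
  rw [div_mul_eq_mul_div, le_div_iff₀ (by positivity)]
  linarith

end Mesh

end RKSV

/-! ### Assembly of the space and time estimates. -/

/-- Monotonicity stability of the RKSV scheme. The CFL constant depends only on the polynomial
degree, the Runge--Kutta method, the wave speed, the quasi-uniformity constant `K` and the lower
bound `ρ` for the (positive, scaled) quantities in the assumption on the subdivision. -/
theorem mainTheorem6 (k r : ℕ) (hr : r ≡ 3 [MOD 4]) (rk : RKSV.RKMethod r)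
    (hrk : rk.HasOrder r) (β : ℝ) (hβ : 0 < β) (K ρ : ℝ) (hK : 0 < K) (hρ : 0 < ρ) :
    ∃ C : ℝ, 0 < C ∧
      ∀ (N : ℕ) [NeZero N] (M : RKSV.Mesh N k),
        (∀ i, M.meshSize ≤ K * M.cellSize i) →
        M.Admissible →
        (1 ≤ k → ∀ i, ρ * M.cellSize i ≤ M.margin i) →
        M.Upwind →
        ∀ τ : ℝ, 0 < τ → τ / M.meshSize ≤ C →
          ∀ u : ℕ → Fin N → Polynomial ℝ,
            RKSV.IsSolution M rk β τ (fun _ _ _ => 0) u →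
            ∀ n : ℕ, M.energyNorm (u (n + 1)) ^ 2 ≤ M.energyNorm (u n) ^ 2 := by
  open RKSV RKSV.Mesh in
  obtain ⟨ε, hε, hstep⟩ := exists_step_stable hr rk hrk
  obtain ⟨B, hB, hinv⟩ := exists_inverse_inequality k
  have hμ : 0 < min 1 ρ := lt_min one_pos hρ
  have hB0 : 0 < B := zero_lt_one.trans_le hB
  -- Chosen so that `τ / h ≤ C` is the same as `τ * Λ ≤ ε`, with `Λ` the bound of the advection form
  -- introduced below.
  refine ⟨ε / (3 * β * B * (K / min 1 ρ)), by positivity, ?_⟩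
  intro N _ M hqu hM hmargin hup τ hτ hCFL u ⟨U, hU, hU0, hUstep, hUend⟩ n
  have hh := M.meshSize_pos
  have hnn : ∀ v : space N k, 0 ≤ M.massForm v v := fun v => by
    by_cases hv : v = 0
    · simp [hv]
    · exact (massForm_pos hM hρ hmargin hv).le
  set Λ : ℝ := 3 * β * B * (K / (M.meshSize * min 1 ρ)) with hΛ
  have hΛ0 : 0 ≤ Λ := by positivity
  have hbound : ∀ v w : space N k, M.advectionForm β v w ^ 2 ≤
      Λ ^ 2 * (M.massForm v v * M.massForm w w) := by
    intro v w
    have h := abs_svForm_le hM hup hβ.le hB hinv v.2 w.2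
    have hv := sum_unitIntegral_le_massForm hM hρ hmargin hqu hK v
    have hw := sum_unitIntegral_le_massForm hM hρ hmargin hqu hK w
    have hv0 : 0 ≤ ∑ i, unitIntegral (M.pull i (v.1 i) ^ 2) :=
      Finset.sum_nonneg fun i _ => unitIntegral_sq_nonneg _
    have hw0 : 0 ≤ ∑ i, unitIntegral (M.pull i (w.1 i) ^ 2) :=
      Finset.sum_nonneg fun i _ => unitIntegral_sq_nonneg _
    rw [advectionForm_apply, ← sq_abs]
    refine (pow_le_pow_left₀ (abs_nonneg _) h 2).trans ?_
    rw [mul_pow, mul_pow (Real.sqrt _), Real.sq_sqrt hv0, Real.sq_sqrt hw0]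
    calc (3 * β * B) ^ 2 * ((∑ i, unitIntegral (M.pull i (v.1 i) ^ 2)) *
          ∑ i, unitIntegral (M.pull i (w.1 i) ^ 2))
        ≤ (3 * β * B) ^ 2 * ((K / (M.meshSize * min 1 ρ) * M.massForm v v) *
          (K / (M.meshSize * min 1 ρ) * M.massForm w w)) := by
          refine mul_le_mul_of_nonneg_left ?_ (sq_nonneg _)
          exact mul_le_mul hv hw hw0 (mul_nonneg (by positivity) (hnn v))
      _ = _ := by
          rw [hΛ]
          ring
  have hτΛ : τ * Λ ≤ ε := by
    rw [le_div_iff₀ (by positivity)] at hCFL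
    refine le_trans (le_of_eq ?_) hCFL
    rw [hΛ]
    field_simp
  -- Stages beyond `r` need not lie in the space; the default `0` is harmless since only indices up
  -- to `r` are used.
  let Us : ℕ → space N k := fun ℓ => if h : ℓ ≤ r then ⟨U n ℓ, hU n ℓ h⟩ else 0
  have hUs : ∀ ℓ ≤ r, (Us ℓ : Fin N → Polynomial ℝ) = U n ℓ := fun ℓ h => by
    simp only [Us, dif_pos h]
  have key := hstep M.massForm (M.advectionForm β) Λ τ M.massForm_isSymm
    (fun v hv => massForm_pos hM hρ hmargin hv)
    (fun v => svForm_self_nonpos hM hup hβ.le v.2) hbound hΛ0 hτ hτΛ Us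
    (fun ℓ hℓ w => by
      rw [massForm_apply hM, hUs (ℓ + 1) hℓ, hUstep n ℓ hℓ w w.2]
      refine Finset.sum_congr rfl fun κ hκ => ?_
      have hκ' : κ ≤ r := (Nat.lt_succ_iff.1 (Finset.mem_range.1 hκ)).trans hℓ.le
      rw [massForm_apply hM, advectionForm_apply, hUs κ hκ']
      simp [pairing])
  have hle : M.starInner (u (n + 1)) (u (n + 1)) ≤ M.starInner (u n) (u n) := by
    rwa [massForm_apply hM, massForm_apply hM, hUs r le_rfl, hUs 0 r.zero_le, hU0, ← hUend] at key
  rw [energyNorm, energyNorm]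
  exact pow_le_pow_left₀ (Real.sqrt_nonneg _) (Real.sqrt_le_sqrt hle) 2
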